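/- **Setting.** Let $\Gamma$ be a $\mathbb Z^n$-periodic metric graph: it is obtained from a directed graph with a countably infinite set $\mathcal V$ of vertices, without loops and multiple edges and with finite positive valencies, and from a length function $l>0$ on the edges, by gluing the segments $[0,l(e)]$ at common vertices. It carries the quotient topology, the path distance $\rho$ and the measure $dx$ given by Lebesgue measure on each edge. The group $\mathbb Z^n$ acts freely on $\Gamma$, written $x\mapsto x+g$, mapping vertices to vertices and edges isometrically onto edges; $\rho(x,y+g)\to\infty$ as $g\to\infty$ for all $x,y\in\Gamma$; and $\Gamma/\mathbb Z^n$ is compact. Let $\Gamma_0\subset\Gamma$ be a fundamental domain, i.e. a relatively compact Borel set such that the sets $\Gamma_g:=\Gamma_0+g$, $g\in\mathbb Z^n$, form a partition of $\Gamma$, and let $\chi_g$ be the characteristic function of $\Gamma_g$. Let $w:\Gamma\to[0,\infty]$ be a $\mathbb Z^n$-periodic weight which is continuous outside of $\mathcal V$ and takes the values $0$ and $\infty$ at most at vertices. Let $1<p<\infty$, and let $L^p_w(\Gamma)$ be the space of the measurable functions $u:\Gamma\to\mathbb C$ with $\|u\|^p=\int_\Gamma |w(x)u(x)|^p\,dx<\infty$,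 on which the shifts $(V_gu)(x)=u(x-g)$ act as isometries. Let $\dot\Gamma$ be the one-point compactification of $\Gamma$, and let $\chi_S$ denote the characteristic function of $S$, also regarded as a multiplication operator. Let $A$ be a bounded linear operator on $L^p_w(\Gamma)$. - $A$ belongs to the Wiener algebra $W_w(\Gamma)$ if $\sum_{\beta\in\mathbb Z^n}\sup_{\alpha\in\mathbb Z^n}\|\chi_\alpha A\chi_{\alpha-\beta}\|<\infty$. - $A$ is of local type on $\dot\Gamma$ if $\chi_{F_1}A\chi_{F_2}$ is compact for all open sets $F_1,F_2\subset\dot\Gamma$ with disjoint closures. - $A$ is locally Fredholm at $x\in\dot\Gamma$ if there are an open neighborhood $F\subset\dot\Gamma$ of $x$ and bounded operators $L,R$ such that $LA\chi_F-\chi_F$ and $\chi_FAR-\chi_F$ are compact. - A bounded operator $A^h$ is the limit operator of $A$ defined by a sequence $h:\mathbb N\to\mathbb Z^n$ tending to infinity if, for every compact $M\subset\Gamma$, both $\|(V_{h(m)}^{-1}AV_{h(m)}-A^h)\chi_M\|$ and $\|\chi_M(V_{h(m)}^{-1}AV_{h(m)}-A^h)\|$ tend to $0$ as $m\to\infty$.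 - $A$ is rich if every sequence $h:\mathbb N\to\mathbb Z^n$ tending to infinity has a subsequence which defines a limit operator of $A$. **Theorem t1.** Let $A\in W_w(\Gamma)$ be rich and of local type on $\dot\Gamma$. Then $A$ is a Fredholm operator on $L^p_w(\Gamma)$ if and only if $A$ is locally Fredholm at every point $x\in\Gamma$ and all limit operators of $A$ are invertible on $L^p_w(\Gamma)$. -/

import Mathlib

open Set Filter Topology MeasureTheory
open scoped ENNReal

noncomputable section

/-! ### Metric graphs -/

/-- A directed combinatorial graph without loops and without multiple edges in which every
vertex has finite positive valency, together with a length function on the edges. -/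
structure MetricGraph (V : Type*) where
  /-- the oriented edges; `(v, w)` starts at `v` and ends at `w` -/
  edges : Set (V × V)
  no_loop : ∀ v, (v, v) ∉ edges
  no_multiple : ∀ v w, (v, w) ∈ edges → (w, v) ∉ edges
  valency_finite : ∀ v, {e ∈ edges | e.1 = v ∨ e.2 = v}.Finite
  valency_pos : ∀ v, {e ∈ edges | e.1 = v ∨ e.2 = v}.Nonempty
  /-- the length function -/
  len : edges → ℝ
  len_pos : ∀ e, 0 < len e

namespace MetricGraph

variable {V : Type*} (G : MetricGraph V)

/-- The disjoint union of the segments `[0, l(e)]`, `e` an edge, with its natural topology. -/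
abbrev PreSpace : Type _ := Σ e : G.edges, Icc (0 : ℝ) (G.len e)

open Classical in
/-- The map to vertices and edges: endpoints of a segment go to the start and the end vertex of
the edge, interior points go to the edge. -/
def preProj (q : G.PreSpace) : V ⊕ G.edges :=
  if (q.2 : ℝ) = 0 then Sum.inl q.1.1.1
  else if (q.2 : ℝ) = G.len q.1 then Sum.inl q.1.1.2
  else Sum.inr q.1

/-- Endpoints of segments are identified if they belong to the same vertex. -/
def setoid : Setoid G.PreSpace where
  r q q' := q = q' ∨ ∃ v, G.preProj q = Sum.inl v ∧ G.preProj q' = Sum.inl v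
  iseqv :=
    { refl := fun _ => Or.inl rfl
      symm := by
        rintro q q' (h | ⟨v, h, h'⟩)
        · exact Or.inl h.symm
        · exact Or.inr ⟨v, h', h⟩
      trans := by
        rintro q q' q'' (rfl | ⟨v, h, h'⟩) (rfl | ⟨u, k, k'⟩)
        · exact Or.inl rfl
        · exact Or.inr ⟨u, k, k'⟩
        · exact Or.inr ⟨v, h, h'⟩
        · exact Or.inr ⟨v, h, by rw [k', ← k, h']⟩ }

/-- The metric graph as a point set. -/
def Space : Type _ := Quotient G.setoid

/-- The quotient map from the disjoint union of the segments. -/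
def toSpace (q : G.PreSpace) : G.Space := Quotient.mk G.setoid q

/-- The quotient topology. -/
instance : TopologicalSpace G.Space := inferInstanceAs (TopologicalSpace (Quotient G.setoid))

instance : MeasurableSpace G.Space := borel _

instance : BorelSpace G.Space := ⟨rfl⟩

/-- The point of the closed edge `e` with local coordinate `x ∈ [0, l(e)]`
(values `x` outside of `[0, l(e)]` are clamped). -/
def pt (e : G.edges) (x : ℝ) : G.Space := G.toSpace ⟨e, projIcc 0 (G.len e) (G.len_pos e).le x⟩

/-- The set of the vertices of the metric graph. -/
def vertices : Set G.Space := {x | ∃ q v, G.toSpace q = x ∧ G.preProj q = Sum.inl v}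

/-- `G.VertexPath v w s`: there is a path of length `s` in the undirected combinatorial graph
which joins `v` with `w`. -/
inductive VertexPath : V → V → ℝ → Prop
  | nil (v : V) : VertexPath v v 0
  | cons {u v w : V} {s : ℝ} (e : G.edges) (he : e.1 = (u, v) ∨ e.1 = (v, u))
      (h : VertexPath v w s) : VertexPath u w (G.len e + s)

/-- `G.SegmentLength q v s`: the vertex `v` is an endpoint of the closed edge containing `q`, and
`s` is the length of the segment joining `q` with that endpoint. -/
def SegmentLength (q : G.PreSpace) (v : V) (s : ℝ) : Prop :=
  (v = q.1.1.1 ∧ s = q.2) ∨ (v = q.1.1.2 ∧ s = G.len q.1 - q.2)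

/-- `s` is the length of a path between `q` and `q'`. -/
def IsPathLength (q q' : G.PreSpace) (s : ℝ) : Prop :=
  (∃ v v' a b c, G.SegmentLength q v a ∧ G.VertexPath v v' b ∧ G.SegmentLength q' v' c ∧
    s = a + b + c) ∨
  (q.1 = q'.1 ∧ s = |(q.2 : ℝ) - q'.2|)

/-- The distance of two points: the infimum of the lengths of the paths joining them
(`∞` if there is no path). -/
def rho (x y : G.Space) : ℝ≥0∞ :=
  sInf {r | ∃ q q' s, G.toSpace q = x ∧ G.toSpace q' = y ∧ G.IsPathLength q q' s ∧ r = ENNReal.ofReal s}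

/-- The measure induced by the one-dimensional Lebesgue measure on each edge. -/
def measure : Measure G.Space :=
  Measure.sum fun e : G.edges => (volume.restrict (Icc (0 : ℝ) (G.len e))).map (G.pt e)

lemma continuous_toSpace : Continuous G.toSpace := continuous_quotient_mk'

lemma continuous_pt (e : G.edges) : Continuous (G.pt e) :=
  G.continuous_toSpace.comp (continuous_sigmaMk.comp continuous_projIcc)

lemma toSpace_eq_pt (e : G.edges) (t : Icc (0 : ℝ) (G.len e)) : G.toSpace ⟨e, t⟩ = G.pt e t := by
  simp [pt]

lemma pt_half_injective {e e' : G.edges} (h : G.pt e (G.len e / 2) = G.pt e' (G.len e' / 2)) :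
    e = e' := by
  have h1 := Quotient.exact h
  rcases h1 with h1 | ⟨v, h1, -⟩
  · exact congrArg Sigma.fst h1
  · exfalso
    have hl := G.len_pos e
    have hm : G.len e / 2 ∈ Icc 0 (G.len e) := ⟨by linarith, by linarith⟩
    rw [projIcc_of_mem _ hm] at h1
    have h2 : G.len e / 2 ≠ 0 := by linarith
    have h3 : G.len e / 2 ≠ G.len e := by intro h; linarith
    simp [preProj, h2, h3] at h1

end MetricGraph

/-! ### Periodic metric graphs -/

/-- A `ℤⁿ`-periodic metric graph with cocompact action. The image `x + g` of the point `x` under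
`g` is written `g +ᵥ x`. -/
structure PeriodicMetricGraph (n : ℕ) (V : Type*) extends MetricGraph V where
  /-- the group `ℤⁿ` acts on the metric graph -/
  action : AddAction (Fin n → ℤ) toMetricGraph.Space
  /-- the action is free -/
  free : ∀ (g : Fin n → ℤ) (x : toMetricGraph.Space), g +ᵥ x = x → g = 0
  map_vertices : ∀ (g : Fin n → ℤ), ∀ x ∈ toMetricGraph.vertices, g +ᵥ x ∈ toMetricGraph.vertices
  /-- closed edges are mapped isometrically onto closed edges of the same length, where the
  orientation may be reversed -/
  map_edges : ∀ (g : Fin n → ℤ) (e : edges), ∃ e' : edges, len e' = len e ∧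
    ((∀ x ∈ Icc 0 (len e), g +ᵥ toMetricGraph.pt e x = toMetricGraph.pt e' x) ∨
     (∀ x ∈ Icc 0 (len e), g +ᵥ toMetricGraph.pt e x = toMetricGraph.pt e' (len e - x)))
  /-- `ρ(x, y + g) → ∞` as `g → ∞` in `ℤⁿ` -/
  rho_tendsto : ∀ x y : toMetricGraph.Space,
    Tendsto (fun g : Fin n → ℤ => toMetricGraph.rho x (g +ᵥ y)) cofinite (𝓝 ∞)
  /-- the orbit space is compact -/
  cocompact : CompactSpace (Quotient (AddAction.orbitRel (Fin n → ℤ) toMetricGraph.Space))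

namespace PeriodicMetricGraph

variable {n : ℕ} {V : Type*} (Γ : PeriodicMetricGraph n V)

instance : AddAction (Fin n → ℤ) Γ.Space := Γ.action

lemma continuous_vadd (g : Fin n → ℤ) : Continuous fun x : Γ.Space => g +ᵥ x := by
  refine Continuous.quotient_lift (s := Γ.setoid)
    (f := fun q => g +ᵥ Γ.toSpace q) ?_ (fun a b h => congrArg (g +ᵥ ·) (Quotient.sound h)) |>.congr ?_
  · refine continuous_sigma fun e => ?_
    obtain ⟨e', -, h | h⟩ := Γ.map_edges g e
    · have : (fun t : Icc (0 : ℝ) (Γ.len e) => g +ᵥ Γ.toSpace ⟨e, t⟩) = fun t : Icc (0 : ℝ) (Γ.len e) => Γ.pt e' t := by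
        funext t
        rw [Γ.toSpace_eq_pt, h t t.2]
      rw [this]
      exact (Γ.continuous_pt e').comp continuous_subtype_val
    · have : (fun t : Icc (0 : ℝ) (Γ.len e) => g +ᵥ Γ.toSpace ⟨e, t⟩) =
          fun t : Icc (0 : ℝ) (Γ.len e) => Γ.pt e' (Γ.len e - t) := by
        funext t
        rw [Γ.toSpace_eq_pt, h t t.2]
      rw [this]
      exact (Γ.continuous_pt e').comp (continuous_const.sub continuous_subtype_val)
  · intro x
    induction x using Quotient.inductionOn with
    | _ q => rfl

lemma exists_edgeEquiv (g : Fin n → ℤ) : ∃ σ : Γ.edges ≃ Γ.edges, ∀ e,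
    Γ.len (σ e) = Γ.len e ∧
    ((∀ x ∈ Icc 0 (Γ.len e), g +ᵥ Γ.pt e x = Γ.pt (σ e) x) ∨
     (∀ x ∈ Icc 0 (Γ.len e), g +ᵥ Γ.pt e x = Γ.pt (σ e) (Γ.len e - x))) := by
  choose s hs using Γ.map_edges
  have mid : ∀ g e, g +ᵥ Γ.pt e (Γ.len e / 2) = Γ.pt (s g e) (Γ.len (s g e) / 2) := by
    intro g e
    have hl := Γ.len_pos e
    have hm : Γ.len e / 2 ∈ Icc 0 (Γ.len e) := ⟨by linarith, by linarith⟩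
    obtain ⟨h1, h | h⟩ := hs g e
    · rw [h _ hm, h1]
    · rw [h _ hm, h1]
      congr 1
      ring
  have inv : ∀ g e, s (-g) (s g e) = e := by
    intro g e
    apply Γ.pt_half_injective
    rw [← mid, ← mid, neg_vadd_vadd]
  refine ⟨⟨s g, s (-g), inv g, fun e => ?_⟩, hs g⟩
  simpa using inv (-g) e

lemma measurePreserving_vadd (g : Fin n → ℤ) :
    MeasurePreserving (fun x : Γ.Space => g +ᵥ x) Γ.measure Γ.measure := by
  have hm : Measurable fun x : Γ.Space => g +ᵥ x := (Γ.continuous_vadd g).measurable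
  refine ⟨hm, ?_⟩
  obtain ⟨σ, hσ⟩ := Γ.exists_edgeEquiv g
  unfold MetricGraph.measure
  rw [Measure.map_sum hm.aemeasurable, ← Measure.sum_comp_equiv σ (fun e : Γ.edges =>
    (volume.restrict (Icc (0 : ℝ) (Γ.len e))).map (Γ.pt e))]
  congr 1
  funext e
  obtain ⟨hl, h⟩ := hσ e
  have hp := (Γ.continuous_pt e).measurable
  have hp' := (Γ.continuous_pt (σ e)).measurable
  simp only [Function.comp_apply]
  rw [Measure.map_map hm hp, hl]
  rcases h with h | h
  · refine Measure.map_congr ?_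
    filter_upwards [ae_restrict_mem measurableSet_Icc] with x hx using h x hx
  · have hr : MeasurePreserving (fun x : ℝ => Γ.len e - x)
        (volume.restrict (Icc (0 : ℝ) (Γ.len e))) (volume.restrict (Icc (0 : ℝ) (Γ.len e))) := by
      have := (Measure.measurePreserving_sub_left (volume : Measure ℝ)
        (Γ.len e)).restrict_preimage (s := Icc (0 : ℝ) (Γ.len e)) measurableSet_Icc
      simpa using this
    conv_rhs => rw [← hr.map_eq, Measure.map_map hp' hr.measurable]
    refine Measure.map_congr ?_
    filter_upwards [ae_restrict_mem measurableSet_Icc] with x hx using h x hx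

end PeriodicMetricGraph

/-! ### Weighted Lebesgue spaces -/

/-- A periodic weight: continuous outside of the vertices, with the values `0` and `∞` attained
at vertices only. -/
structure PeriodicWeight {n : ℕ} {V : Type*} (Γ : PeriodicMetricGraph n V) where
  toFun : Γ.Space → ℝ≥0∞
  continuousOn : ContinuousOn toFun Γ.verticesᶜ
  mem_vertices : ∀ x, toFun x = 0 ∨ toFun x = ∞ → x ∈ Γ.vertices
  periodic : ∀ (g : Fin n → ℤ) x, toFun (g +ᵥ x) = toFun x

/-- The measure `w(x)^p dx`. -/
def PeriodicMetricGraph.weightedMeasure {n : ℕ} {V : Type*} (Γ : PeriodicMetricGraph n V)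
    (w : PeriodicWeight Γ) (p : ℝ≥0∞) : Measure Γ.Space :=
  Γ.measure.withDensity fun x => w.toFun x ^ p.toReal

/-- For `p < ∞`, the space of the functions `u` with `‖u‖ ^ p = ∫ |w u|^p dx < ∞`. -/
abbrev LpW {n : ℕ} {V : Type*} (Γ : PeriodicMetricGraph n V) (w : PeriodicWeight Γ)
    (p : ℝ≥0∞) : Type _ :=
  Lp ℂ p (Γ.weightedMeasure w p)

lemma PeriodicMetricGraph.measurePreserving_weighted {n : ℕ} {V : Type*}
    (Γ : PeriodicMetricGraph n V) (w : PeriodicWeight Γ) (p : ℝ≥0∞) (g : Fin n → ℤ) :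
    MeasurePreserving (fun x : Γ.Space => g +ᵥ x) (Γ.weightedMeasure w p)
      (Γ.weightedMeasure w p) := by
  have hg := Γ.measurePreserving_vadd g
  have he : MeasurableEmbedding (fun x : Γ.Space => g +ᵥ x) :=
    (MeasurableEquiv.mk (AddAction.toPerm g) (Γ.continuous_vadd g).measurable
      (Γ.continuous_vadd (-g)).measurable).measurableEmbedding
  refine ⟨hg.measurable, ?_⟩
  ext s hs
  unfold PeriodicMetricGraph.weightedMeasure
  rw [Measure.map_apply hg.measurable hs, withDensity_apply _ (hg.measurable hs),
    withDensity_apply _ hs, ← hg.setLIntegral_comp_preimage_emb he _ s]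
  simp only [w.periodic]

lemma memLp_indicator {α : Type*} [MeasurableSpace α] (μ : Measure α) (p : ℝ≥0∞) (S : Set α)
    (hS : MeasurableSet S) (u : Lp ℂ p μ) : MemLp (S.indicator (u : α → ℂ)) p μ :=
  MemLp.indicator hS (Lp.memLp u)

/-- Multiplication by the characteristic function of a measurable set. -/
def chiFun {α : Type*} [MeasurableSpace α] (μ : Measure α) (p : ℝ≥0∞) (S : Set α)
    (hS : MeasurableSet S) (u : Lp ℂ p μ) : Lp ℂ p μ :=
  (memLp_indicator μ p S hS u).toLp (S.indicator (u : α → ℂ))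

lemma coeFn_chiFun {α : Type*} [MeasurableSpace α] (μ : Measure α) (p : ℝ≥0∞) (S : Set α)
    (hS : MeasurableSet S) (u : Lp ℂ p μ) :
    chiFun μ p S hS u =ᵐ[μ] S.indicator (u : α → ℂ) :=
  MemLp.coeFn_toLp (memLp_indicator μ p S hS u)

lemma chiFun_add {α : Type*} [MeasurableSpace α] (μ : Measure α) (p : ℝ≥0∞) (S : Set α)
    (hS : MeasurableSet S) (u v : Lp ℂ p μ) :
    chiFun μ p S hS (u + v) = chiFun μ p S hS u + chiFun μ p S hS v := by
  apply Lp.ext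
  filter_upwards [Lp.coeFn_add u v, Lp.coeFn_add (chiFun μ p S hS u) (chiFun μ p S hS v),
    coeFn_chiFun μ p S hS u, coeFn_chiFun μ p S hS v, coeFn_chiFun μ p S hS (u + v)]
    with x h1 h2 h3 h4 h5
  rw [h2, h5, Pi.add_apply, h3, h4]
  by_cases h : x ∈ S
  · rw [indicator_of_mem h, indicator_of_mem h, indicator_of_mem h, h1, Pi.add_apply]
  · rw [indicator_of_notMem h, indicator_of_notMem h, indicator_of_notMem h, add_zero]

lemma chiFun_smul {α : Type*} [MeasurableSpace α] (μ : Measure α) (p : ℝ≥0∞) (S : Set α)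
    (hS : MeasurableSet S) (c : ℂ) (u : Lp ℂ p μ) :
    chiFun μ p S hS (c • u) = c • chiFun μ p S hS u := by
  apply Lp.ext
  filter_upwards [Lp.coeFn_smul c u, Lp.coeFn_smul c (chiFun μ p S hS u),
    coeFn_chiFun μ p S hS u, coeFn_chiFun μ p S hS (c • u)] with x h1 h2 h3 h4
  rw [h2, h4, Pi.smul_apply, h3]
  by_cases h : x ∈ S
  · rw [indicator_of_mem h, indicator_of_mem h, h1, Pi.smul_apply]
  · rw [indicator_of_notMem h, indicator_of_notMem h, smul_zero]

lemma norm_chiFun_le {α : Type*} [MeasurableSpace α] (μ : Measure α) (p : ℝ≥0∞)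
    (S : Set α) (hS : MeasurableSet S) (u : Lp ℂ p μ) :
    ‖chiFun μ p S hS u‖ ≤ 1 * ‖u‖ := by
  rw [one_mul]
  apply Lp.norm_le_norm_of_ae_le
  filter_upwards [coeFn_chiFun μ p S hS u] with x hx
  rw [hx]
  exact norm_indicator_le_norm_self _ _

/-- The operator of multiplication by the characteristic function of a measurable set. -/
def chi {α : Type*} [MeasurableSpace α] (μ : Measure α) (p : ℝ≥0∞) [Fact (1 ≤ p)] (S : Set α)
    (hS : MeasurableSet S) : Lp ℂ p μ →L[ℂ] Lp ℂ p μ :=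
  LinearMap.mkContinuous
    { toFun := chiFun μ p S hS
      map_add' := chiFun_add μ p S hS
      map_smul' := chiFun_smul μ p S hS }
    1 (norm_chiFun_le μ p S hS)

section Operators

variable {n : ℕ} {V : Type*} {Γ : PeriodicMetricGraph n V} {w : PeriodicWeight Γ}
  {p : ℝ≥0∞} [Fact (1 ≤ p)]

/-- The shift operator `(V_g u)(x) = u(x - g)`. -/
def shift (Γ : PeriodicMetricGraph n V) (w : PeriodicWeight Γ) (p : ℝ≥0∞) [Fact (1 ≤ p)]
    (g : Fin n → ℤ) : LpW Γ w p →L[ℂ] LpW Γ w p :=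
  (Lp.compMeasurePreservingₗᵢ ℂ (fun x : Γ.Space => -g +ᵥ x)
    (Γ.measurePreserving_weighted w p (-g))).toContinuousLinearMap

/-- The operator of multiplication by the characteristic function of a measurable subset of the
metric graph. -/
def chiW (Γ : PeriodicMetricGraph n V) (w : PeriodicWeight Γ) (p : ℝ≥0∞) [Fact (1 ≤ p)]
    (S : Set Γ.Space) (hS : MeasurableSet S) : LpW Γ w p →L[ℂ] LpW Γ w p :=
  chi (Γ.weightedMeasure w p) p S hS

/-- A fundamental domain: a relatively compact Borel set whose translates `D + g` form a
partition of the metric graph. -/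
structure IsFundDomain (Γ : PeriodicMetricGraph n V) (D : Set Γ.Space) : Prop where
  measurableSet : MeasurableSet D
  isCompact_closure : IsCompact (closure D)
  existsUnique : ∀ x : Γ.Space, ∃! g : Fin n → ℤ, -g +ᵥ x ∈ D

/-- The translate `D + g`. -/
def cell (D : Set Γ.Space) (g : Fin n → ℤ) : Set Γ.Space := (fun x => -g +ᵥ x) ⁻¹' D

lemma IsFundDomain.measurableSet_cell {D : Set Γ.Space} (hD : IsFundDomain Γ D)
    (g : Fin n → ℤ) : MeasurableSet (cell D g) :=
  (Γ.continuous_vadd (-g)).measurable hD.measurableSet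

/-- Membership in the Wiener algebra: `∑_β sup_α ‖χ_α A χ_{α-β}‖ < ∞`, where `χ_g` is the
characteristic function of `D + g`. This is the norm `∑_β sup_α ‖a_β(α)‖` of the operator
`∑_β a_β τ_β` on the space of `ℤⁿ`-sequences which corresponds to `A`. -/
def InWiener {D : Set Γ.Space} (hD : IsFundDomain Γ D) (A : LpW Γ w p →L[ℂ] LpW Γ w p) : Prop :=
  ∑' β : Fin n → ℤ, ⨆ α : Fin n → ℤ,
    ‖chiW Γ w p (cell D α) (hD.measurableSet_cell α) ∘L A ∘L
      chiW Γ w p (cell D (α - β)) (hD.measurableSet_cell (α - β))‖ₑ < ∞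

/-- The characteristic function of an open subset of the one-point compactification. -/
def chiOpen (Γ : PeriodicMetricGraph n V) (w : PeriodicWeight Γ) (p : ℝ≥0∞) [Fact (1 ≤ p)]
    (F : Set (OnePoint Γ.Space)) (hF : IsOpen F) : LpW Γ w p →L[ℂ] LpW Γ w p :=
  chiW Γ w p ((↑) ⁻¹' F) (hF.preimage OnePoint.continuous_coe).measurableSet

/-- Operators of local type on the one-point compactification. -/
def IsLocalType (A : LpW Γ w p →L[ℂ] LpW Γ w p) : Prop :=
  ∀ (F₁ F₂ : Set (OnePoint Γ.Space)) (h₁ : IsOpen F₁) (h₂ : IsOpen F₂),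
    Disjoint (closure F₁) (closure F₂) →
      IsCompactOperator (chiOpen Γ w p F₁ h₁ ∘L A ∘L chiOpen Γ w p F₂ h₂)

/-- Local Fredholmness at a point of the one-point compactification. -/
def IsLocallyFredholmAt (A : LpW Γ w p →L[ℂ] LpW Γ w p) (x : OnePoint Γ.Space) : Prop :=
  ∃ (F : Set (OnePoint Γ.Space)) (hF : IsOpen F) (L R : LpW Γ w p →L[ℂ] LpW Γ w p),
    x ∈ F ∧
    IsCompactOperator (L ∘L A ∘L chiOpen Γ w p F hF - chiOpen Γ w p F hF) ∧
    IsCompactOperator (chiOpen Γ w p F hF ∘L A ∘L R - chiOpen Γ w p F hF)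

/-- `B` is the limit operator of `A` defined by the sequence `h` (note that
`V_{h(m)}⁻¹ = V_{-h(m)}`, and that compact subsets of the metric graph are Borel sets). -/
def IsLimitOperator (A : LpW Γ w p →L[ℂ] LpW Γ w p) (h : ℕ → Fin n → ℤ)
    (B : LpW Γ w p →L[ℂ] LpW Γ w p) : Prop :=
  ∀ (M : Set Γ.Space) (hM : MeasurableSet M), IsCompact M →
    Tendsto (fun m => ‖(shift Γ w p (-h m) ∘L A ∘L shift Γ w p (h m) - B) ∘L chiW Γ w p M hM‖)
      atTop (𝓝 0) ∧
    Tendsto (fun m => ‖chiW Γ w p M hM ∘L (shift Γ w p (-h m) ∘L A ∘L shift Γ w p (h m) - B)‖)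
      atTop (𝓝 0)

/-- The sequences in `ℤⁿ` which tend to infinity. -/
def TendsToInfinity (h : ℕ → Fin n → ℤ) : Prop := Tendsto h atTop cofinite

/-- Rich operators: every sequence tending to infinity has a subsequence which defines a limit
operator. -/
def IsRich (A : LpW Γ w p →L[ℂ] LpW Γ w p) : Prop :=
  ∀ h : ℕ → Fin n → ℤ, TendsToInfinity h →
    ∃ φ : ℕ → ℕ, StrictMono φ ∧ ∃ B : LpW Γ w p →L[ℂ] LpW Γ w p, IsLimitOperator A (h ∘ φ) B

end Operators

end

noncomputable section

/-! ### Banach spaces with an `ℓ^p`-decomposition -/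

/-! Cutting functions along the cells turns the weighted space into an `ℓ^p`-sum of blocks indexed
by `ℤⁿ`, on which the shifts act by translation of the index. Since `1 < p`, the dual is the
corresponding `ℓ^q`-sum with `q < ∞` (`LpDecomp.dual`), so every estimate for `A` can be repeated
for its adjoint.

Necessity. A regularizer of a Fredholm operator serves as a local one at each point and gives `‖u‖ ≤
C‖Au‖ + ‖Ku‖` with `K` compact. For shifted vectors the compact term tends to zero, so the estimate
passes without it to every limit operator. With the dual estimate this yields invertibility
(`isUnit_limit_of_isFredholm`).

Sufficiency. The core is `LpDecomp.exists_lower_bound_at_infinity`. An operator in the Wiener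
algebra is a norm limit of band operators, and these nearly commute with projections onto large
boxes. Averaging over all translates of a box shows that a vector on which `A` is small can be cut
to some translate with little loss. Without a lower bound at infinity there are such vectors `u k`
moving to infinity. Each is localized around one point `x k` at all scales `j < k` simultaneously.
Along a subsequence the shifts by `x k` define a limit operator with some lower bound `c`. Only then
is the scale chosen, small relative to `c`, and a contradiction follows. Hence no uniform bound over
all limit operators is needed.

The result is an a priori estimate for `A` and its adjoint near the point at infinity, and local
Fredholmness gives such estimates modulo compact operators near all other points. By compactness of
the one-point compactification finitely many of them suffice. Operators of local type commute with
suitable cutoffs up to compact and small terms (`exists_cutoff`), so the estimates can be glued to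
give finite-dimensional kernel and cokernel (`isFredholm_of_local`). -/

/-- The family `P` of mutually orthogonal projections decomposes the norm in the `ℓ^p`-sense. -/
structure LpDecomp {ι E : Type*} [NormedAddCommGroup E] [NormedSpace ℂ E] (P : ι → E →L[ℂ] E)
    (p : ℝ) : Prop where
  idem : ∀ a u, P a (P a u) = P a u
  orth : ∀ a b, a ≠ b → ∀ u, P a (P b u) = 0
  tsum_enorm : ∀ u, ∑' a, ‖P a u‖ₑ ^ p = ‖u‖ₑ ^ p

/-- The projection which corresponds to a finite set of indices. -/
def finProj {ι E : Type*} [NormedAddCommGroup E] [NormedSpace ℂ E] (P : ι → E →L[ℂ] E)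
    (S : Finset ι) : E →L[ℂ] E := ∑ a ∈ S, P a

namespace LpDecomp

variable {ι E : Type*} [NormedAddCommGroup E] [NormedSpace ℂ E] {P : ι → E →L[ℂ] E} {p : ℝ}

lemma enorm_apply_le (hP : LpDecomp P p) (hp : 0 < p) (a : ι) (u : E) : ‖P a u‖ₑ ≤ ‖u‖ₑ := by
  rw [← ENNReal.rpow_le_rpow_iff hp, ← hP.tsum_enorm u]
  exact ENNReal.le_tsum a

lemma norm_apply_le (hP : LpDecomp P p) (hp : 0 < p) (a : ι) (u : E) : ‖P a u‖ ≤ ‖u‖ := by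
  simpa [enorm_le_iff_norm_le] using hP.enorm_apply_le hp a u

lemma norm_le_one (hP : LpDecomp P p) (hp : 0 < p) (a : ι) : ‖P a‖ ≤ 1 :=
  ContinuousLinearMap.opNorm_le_bound _ zero_le_one fun u => by
    simpa using hP.norm_apply_le hp a u

lemma ext (hP : LpDecomp P p) (hp : 0 < p) {u v : E} (h : ∀ a, P a u = P a v) : u = v := by
  have h1 := hP.tsum_enorm (u - v)
  simp only [map_sub, h, sub_self, enorm_zero, ENNReal.zero_rpow_of_pos hp, tsum_zero] at h1
  have h2 := (ENNReal.rpow_eq_zero_iff_of_pos hp).1 h1.symm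
  exact sub_eq_zero.1 (enorm_eq_zero.1 h2)

open Classical in
lemma apply_sum (hP : LpDecomp P p) (S : Finset ι) (w : ι → E) (b : ι) :
    P b (∑ a ∈ S, P a (w a)) = if b ∈ S then P b (w b) else 0 := by
  rw [map_sum]
  split_ifs with hb
  · rw [Finset.sum_eq_single b (fun a _ hab => hP.orth _ _ hab.symm _) (fun h => (h hb).elim),
      hP.idem]
  · exact Finset.sum_eq_zero fun a ha => hP.orth _ _ (by rintro rfl; exact hb ha) _

lemma enorm_sum (hP : LpDecomp P p) (hp : 0 < p) (S : Finset ι) (w : ι → E) :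
    ‖∑ a ∈ S, P a (w a)‖ₑ ^ p = ∑ a ∈ S, ‖P a (w a)‖ₑ ^ p := by
  classical
  rw [← hP.tsum_enorm, tsum_eq_sum (s := S)]
  · refine Finset.sum_congr rfl fun a ha => ?_
    rw [hP.apply_sum, if_pos ha]
  · intro b hb
    rw [hP.apply_sum, if_neg hb, enorm_zero, ENNReal.zero_rpow_of_pos hp]

lemma norm_sum (hP : LpDecomp P p) (hp : 0 < p) (S : Finset ι) (w : ι → E) :
    ‖∑ a ∈ S, P a (w a)‖ ^ p = ∑ a ∈ S, ‖P a (w a)‖ ^ p := by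
  have h := hP.enorm_sum hp S w
  simp only [← ofReal_norm, ENNReal.ofReal_rpow_of_nonneg (norm_nonneg _) hp.le] at h
  rw [← ENNReal.ofReal_sum_of_nonneg (fun a _ => by positivity)] at h
  exact (ENNReal.ofReal_eq_ofReal_iff (by positivity)
    (Finset.sum_nonneg fun a _ => by positivity)).1 h

open Classical in
lemma apply_finProj (hP : LpDecomp P p) (S : Finset ι) (u : E) (b : ι) :
    P b (finProj P S u) = if b ∈ S then P b u else 0 := by
  simpa [finProj] using hP.apply_sum S (fun _ => u) b

lemma exists_apply_ne_zero (hP : LpDecomp P p) (hp : 0 < p) {u : E} (hu : u ≠ 0) :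
    ∃ a, P a u ≠ 0 := by
  by_contra! h
  exact hu (hP.ext hp fun a => by rw [h, map_zero])

lemma finProj_eq_self (hP : LpDecomp P p) (hp : 0 < p) {S : Finset ι} {u : E}
    (h : ∀ a, P a u ≠ 0 → a ∈ S) : finProj P S u = u := by
  classical
  refine hP.ext hp fun a => ?_
  rw [hP.apply_finProj]
  split_ifs with ha
  · rfl
  · by_contra h0
    exact ha (h a (Ne.symm h0))

/-- Injectivity of `σ` ensures that each block of `u` is used at most once, so blockwise domination
can be summed. -/
lemma enorm_le (hP : LpDecomp P p) (hp : 0 < p) {u v : E} {σ : ι → ι}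
    (hσ : Function.Injective σ) {C : ℝ≥0∞} (h : ∀ a, ‖P a v‖ₑ ≤ C * ‖P (σ a) u‖ₑ) :
    ‖v‖ₑ ≤ C * ‖u‖ₑ := by
  rw [← ENNReal.rpow_le_rpow_iff hp, ENNReal.mul_rpow_of_nonneg _ _ hp.le, ← hP.tsum_enorm v,
    ← hP.tsum_enorm u, ← ENNReal.tsum_mul_left]
  calc ∑' a, ‖P a v‖ₑ ^ p ≤ ∑' a, C ^ p * ‖P (σ a) u‖ₑ ^ p := ENNReal.tsum_le_tsum fun a => by
        rw [← ENNReal.mul_rpow_of_nonneg _ _ hp.le]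
        exact ENNReal.rpow_le_rpow (h a) hp.le
    _ ≤ ∑' a, C ^ p * ‖P a u‖ₑ ^ p :=
        ENNReal.tsum_comp_le_tsum_of_injective hσ (fun a => C ^ p * ‖P a u‖ₑ ^ p)

/-- Cauchy criterion: the `p`-th power of the norm of a partial sum off a finite set is bounded by a
tail of the convergent scalar series. -/
lemma summable [CompleteSpace E] (hP : LpDecomp P p) (hp : 0 < p) {w : ι → E}
    (h : ∑' a, ‖P a (w a)‖ₑ ^ p ≠ ∞) : Summable fun a => P a (w a) := by
  classical
  rw [summable_iff_vanishing_norm]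
  intro ε hε
  have hε' : 0 < ENNReal.ofReal ε ^ p := ENNReal.rpow_pos (by simpa using hε) (by simp)
  obtain ⟨S, hS⟩ := ((ENNReal.tendsto_tsum_compl_atTop_zero h).eventually
    (gt_mem_nhds hε')).exists
  refine ⟨S, fun T hT => ?_⟩
  have h1 : ‖∑ a ∈ T, P a (w a)‖ₑ ^ p < ENNReal.ofReal ε ^ p := by
    rw [hP.enorm_sum hp]
    refine lt_of_le_of_lt ?_ hS
    rw [← Finset.sum_subtype_of_mem (p := fun a => a ∉ S) (fun a => ‖P a (w a)‖ₑ ^ p)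
      (fun a ha => Finset.disjoint_left.1 hT ha)]
    exact ENNReal.sum_le_tsum _
  rw [ENNReal.rpow_lt_rpow_iff hp, ← ofReal_norm, ENNReal.ofReal_lt_ofReal_iff hε] at h1
  exact h1

lemma apply_tsum (hP : LpDecomp P p) {w : ι → E}
    (h : Summable fun a => P a (w a)) (b : ι) : P b (∑' a, P a (w a)) = P b (w b) := by
  rw [ContinuousLinearMap.map_tsum _ h, tsum_eq_single b (fun a hab => hP.orth _ _ hab.symm _),
    hP.idem]

lemma hasSum [CompleteSpace E] (hP : LpDecomp P p) (hp : 0 < p) (u : E) :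
    HasSum (fun a => P a u) u := by
  have h : Summable fun a => P a u := hP.summable hp (w := fun _ => u) (by
    rw [hP.tsum_enorm]
    exact ENNReal.rpow_ne_top_of_nonneg hp.le (by simp))
  convert h.hasSum
  exact hP.ext hp fun a => (hP.apply_tsum h a).symm

lemma tendsto_finProj [CompleteSpace E] (hP : LpDecomp P p) (hp : 0 < p) (u : E) :
    Tendsto (fun S => finProj P S u) atTop (𝓝 u) := by
  simpa [HasSum, finProj] using hP.hasSum hp u

/-- Operators with a prescribed diagonal block structure. -/
lemma exists_blockOp [CompleteSpace E] (hP : LpDecomp P p) (hp : 0 < p) (T : ι → E →L[ℂ] E)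
    {σ : ι → ι} (hσ : Function.Injective σ) {C : ℝ} (hC : 0 ≤ C)
    (hT : ∀ a, ‖P a ∘L T a ∘L P (σ a)‖ ≤ C) :
    ∃ B : E →L[ℂ] E, (∀ a u, P a (B u) = P a (T a (P (σ a) u))) ∧ ‖B‖ ≤ C := by
  have key : ∀ a u, ‖P a (T a (P (σ a) u))‖ₑ ≤ ENNReal.ofReal C * ‖P (σ a) u‖ₑ := by
    intro a u
    rw [← ofReal_norm, ← ofReal_norm, ← ENNReal.ofReal_mul hC]
    refine ENNReal.ofReal_le_ofReal ?_
    have := (P a ∘L T a ∘L P (σ a)).le_of_opNorm_le (hT a) (P (σ a) u)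
    simpa [hP.idem] using this
  have hs : ∀ u, Summable fun a => P a (T a (P (σ a) u)) := by
    intro u
    refine hP.summable hp (ne_top_of_le_ne_top (b := ENNReal.ofReal C ^ p * ‖u‖ₑ ^ p) ?_ ?_)
    · exact ENNReal.mul_ne_top (ENNReal.rpow_ne_top_of_nonneg hp.le (by simp))
        (ENNReal.rpow_ne_top_of_nonneg hp.le (by simp))
    · rw [← hP.tsum_enorm u, ← ENNReal.tsum_mul_left]
      calc ∑' a, ‖P a (T a (P (σ a) u))‖ₑ ^ p
          ≤ ∑' a, ENNReal.ofReal C ^ p * ‖P (σ a) u‖ₑ ^ p := ENNReal.tsum_le_tsum fun a => by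
            rw [← ENNReal.mul_rpow_of_nonneg _ _ hp.le]
            exact ENNReal.rpow_le_rpow (key a u) hp.le
        _ ≤ _ := ENNReal.tsum_comp_le_tsum_of_injective hσ
            (fun a => ENNReal.ofReal C ^ p * ‖P a u‖ₑ ^ p)
  -- Row `a` of the block matrix has its only entry in column `σ a`.
  let L : E →ₗ[ℂ] E :=
    { toFun := fun u => ∑' a, P a (T a (P (σ a) u))
      map_add' := fun u v => by
        rw [← (hs u).tsum_add (hs v)]
        simp
      map_smul' := fun c u => by
        rw [RingHom.id_apply, ← (hs u).tsum_const_smul]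
        simp }
  have hL : ∀ a u, P a (L u) = P a (T a (P (σ a) u)) := fun a u => hP.apply_tsum (hs u) a
  have hb : ∀ u, ‖L u‖ ≤ C * ‖u‖ := by
    intro u
    have h1 : ‖L u‖ₑ ≤ ENNReal.ofReal C * ‖u‖ₑ :=
      hP.enorm_le hp hσ fun a => by rw [hL]; exact key a u
    rw [← ofReal_norm, ← ofReal_norm, ← ENNReal.ofReal_mul hC,
      ENNReal.ofReal_le_ofReal_iff (by positivity)] at h1
    exact h1
  exact ⟨L.mkContinuous C hb, hL, L.mkContinuous_norm_le hC hb⟩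

/-- This is the equality case of Hölder's inequality: `f` is tested on a sum of near-maximizers of
the pieces `f ∘L P a`, weighted with the powers `q - 1` of their norms. -/
lemma sum_norm_comp_rpow_le (hP : LpDecomp P p) {q : ℝ} (hpq : p.HolderConjugate q)
    (f : StrongDual ℂ E) (S : Finset ι) : ∑ a ∈ S, ‖f ∘L P a‖ ^ q ≤ ‖f‖ ^ q := by
  have hp := hpq.pos
  have hq := hpq.symm.pos
  -- The norm of a functional need not be attained, hence the factor `r < 1`, which is sent to `1`
  -- later. Multiplication by a phase makes the values nonnegative, so they add up without
  -- cancellation.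
  have hsel : ∀ r : ℝ, r < 1 → ∀ a, ∃ x : E, ‖x‖ ≤ 1 ∧
      f (P a x) = (‖f (P a x)‖ : ℂ) ∧ r * ‖f ∘L P a‖ ≤ ‖f (P a x)‖ := by
    intro r hr a
    by_cases h0 : ‖f ∘L P a‖ = 0
    · exact ⟨0, by simp, by simp, by simp [h0]⟩
    · have h1 : r * ‖f ∘L P a‖ < ‖f ∘L P a‖ := by
        have := (norm_nonneg (f ∘L P a)).lt_of_ne' h0
        nlinarith
      obtain ⟨x, hx, hx'⟩ := (f ∘L P a).exists_lt_apply_of_lt_opNorm h1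
      obtain ⟨c, hc, hc'⟩ : ∃ c : ℂ, ‖c‖ = 1 ∧ c * f (P a x) = (‖f (P a x)‖ : ℂ) := by
        by_cases hz : f (P a x) = 0
        · exact ⟨1, by simp, by simp [hz]⟩
        · refine ⟨‖f (P a x)‖ / f (P a x), ?_, ?_⟩
          · rw [norm_div, Complex.norm_real, norm_norm, div_self (norm_ne_zero_iff.2 hz)]
          · rw [div_mul_cancel₀ _ hz]
      refine ⟨c • x, ?_, ?_, ?_⟩
      · rw [norm_smul, hc, one_mul]; exact hx.le
      · simp [hc']
      · simp only [map_smul, norm_smul, hc, one_mul]; exact hx'.le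
  set b : ι → ℝ := fun a => ‖f ∘L P a‖ with hb
  have hb0 : ∀ a, 0 ≤ b a := fun a => norm_nonneg _
  set T := ∑ a ∈ S, b a ^ q with hT
  have hT0 : 0 ≤ T := Finset.sum_nonneg fun a _ => Real.rpow_nonneg (hb0 a) _
  have hexp : ∀ a, b a ^ (q - 1) * b a = b a ^ q := fun a => by
    rcases (hb0 a).eq_or_lt with h | h
    · rw [← h, mul_zero, Real.zero_rpow hq.ne']
    · rw [← Real.rpow_add_one h.ne', sub_add_cancel]
  have hexp' : ∀ a, (b a ^ (q - 1)) ^ p = b a ^ q := fun a => by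
    rw [← Real.rpow_mul (hb0 a), mul_comm, hpq.mul_eq_add |> fun h => (by linarith :
      p * (q - 1) = q)]
  have key : ∀ r : ℝ, r < 1 → r * T ≤ ‖f‖ * T ^ (1 / p) := by
    intro r hr
    choose x hx hfx hrx using hsel r hr
    set u : E := ∑ a ∈ S, P a (((b a ^ (q - 1) : ℝ) : ℂ) • x a) with hu
    have h1 : f u = ((∑ a ∈ S, b a ^ (q - 1) * ‖f (P a (x a))‖ : ℝ) : ℂ) := by
      rw [hu, map_sum]
      push_cast
      refine Finset.sum_congr rfl fun a _ => ?_
      rw [map_smul, map_smul, smul_eq_mul, ← hfx a]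
    have h2 : r * T ≤ ‖f u‖ := by
      rw [h1, Complex.norm_real]
      refine le_trans ?_ (le_abs_self _)
      rw [hT, Finset.mul_sum]
      refine Finset.sum_le_sum fun a _ => ?_
      rw [← hexp a, mul_left_comm]
      exact mul_le_mul_of_nonneg_left (hrx a) (Real.rpow_nonneg (hb0 a) _)
    have h3 : ‖u‖ ^ p ≤ T := by
      rw [hu, hP.norm_sum hp]
      refine Finset.sum_le_sum fun a _ => ?_
      rw [← hexp' a]
      refine Real.rpow_le_rpow (norm_nonneg _) ?_ hp.le
      refine (hP.norm_apply_le hp _ _).trans ?_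
      rw [norm_smul, Complex.norm_real, Real.norm_of_nonneg (Real.rpow_nonneg (hb0 a) _)]
      exact mul_le_of_le_one_right (Real.rpow_nonneg (hb0 a) _) (hx a)
    have h4 : ‖u‖ ≤ T ^ (1 / p) := by
      rw [one_div]
      exact (Real.le_rpow_inv_iff_of_pos (norm_nonneg _) hT0 hp).2 h3
    exact h2.trans ((f.le_opNorm u).trans (mul_le_mul_of_nonneg_left h4 (norm_nonneg _)))
  have key1 : T ≤ ‖f‖ * T ^ (1 / p) := by
    have : Tendsto (fun r : ℝ => r * T) (𝓝[<] 1) (𝓝 (1 * T)) :=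
      (tendsto_id.mul_const T).mono_left nhdsWithin_le_nhds
    rw [one_mul] at this
    exact le_of_tendsto this (by filter_upwards [self_mem_nhdsWithin] with r hr using key r hr)
  rcases hT0.eq_or_lt with h | h
  · rw [← h]; positivity
  -- For `T > 0` the factor `T ^ (1 / p)` can be cancelled from `key1`.
  · have h5 : T = T ^ (1 / q) * T ^ (1 / p) := by
      rw [← Real.rpow_add h, one_div, one_div, add_comm, hpq.inv_add_inv_eq_one, Real.rpow_one]
    have h6 : T ^ (1 / q) ≤ ‖f‖ := by
      rw [h5] at key1
      refine le_of_mul_le_mul_right ?_ (Real.rpow_pos_of_pos h (1 / p))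
      rwa [← h5] at key1 ⊢
    rw [one_div] at h6
    exact (Real.rpow_inv_le_iff_of_pos hT0 (norm_nonneg _) hq).1 h6

/-- Hölder's inequality for finite sections of `u`, followed by the limit along the finite sets. -/
lemma enorm_le_tsum_comp [CompleteSpace E] (hP : LpDecomp P p) {q : ℝ}
    (hpq : p.HolderConjugate q) (f : StrongDual ℂ E) :
    ‖f‖ₑ ^ q ≤ ∑' a, ‖f ∘L P a‖ₑ ^ q := by
  have hp := hpq.pos
  have hq := hpq.symm.pos
  set M := ∑' a, ‖f ∘L P a‖ₑ ^ q with hM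
  rcases eq_or_ne M ∞ with h | hMtop
  · rw [h]; exact le_top
  have hMtop' : M ^ (1 / q) ≠ ∞ := ENNReal.rpow_ne_top_of_nonneg (by positivity) hMtop
  have key : ∀ u, ‖f u‖ₑ ≤ M ^ (1 / q) * ‖u‖ₑ := by
    intro u
    have h1 : Tendsto (fun S => ‖f (finProj P S u)‖ₑ) atTop (𝓝 ‖f u‖ₑ) :=
      ((f.continuous.tendsto _).comp (hP.tendsto_finProj hp u)).enorm
    refine le_of_tendsto h1 (Eventually.of_forall fun S => ?_)
    calc ‖f (finProj P S u)‖ₑ = ‖∑ a ∈ S, f (P a (P a u))‖ₑ := by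
          simp [finProj, hP.idem]
      _ ≤ ∑ a ∈ S, ‖f ∘L P a‖ₑ * ‖P a u‖ₑ :=
          (enorm_sum_le _ _).trans (Finset.sum_le_sum fun a _ => (f ∘L P a).le_opENorm _)
      _ ≤ (∑ a ∈ S, ‖f ∘L P a‖ₑ ^ q) ^ (1 / q) * (∑ a ∈ S, ‖P a u‖ₑ ^ p) ^ (1 / p) :=
          ENNReal.inner_le_Lp_mul_Lq _ _ _ hpq.symm
      _ ≤ M ^ (1 / q) * (‖u‖ₑ ^ p) ^ (1 / p) := by
          gcongr
          · exact ENNReal.sum_le_tsum _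
          · rw [← hP.tsum_enorm u]; exact ENNReal.sum_le_tsum _
      _ = M ^ (1 / q) * ‖u‖ₑ := by
          rw [← ENNReal.rpow_mul, mul_one_div_cancel hp.ne', ENNReal.rpow_one]
  have h2 : ‖f‖ₑ ≤ M ^ (1 / q) := by
    rw [← ENNReal.ofReal_toReal hMtop', ← ofReal_norm]
    refine ENNReal.ofReal_le_ofReal (f.opNorm_le_bound ENNReal.toReal_nonneg fun u => ?_)
    have := ENNReal.toReal_mono (ENNReal.mul_ne_top hMtop' (by simp)) (key u)
    simpa using this
  calc ‖f‖ₑ ^ q ≤ (M ^ (1 / q)) ^ q := ENNReal.rpow_le_rpow h2 hq.le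
    _ = M := by rw [← ENNReal.rpow_mul, one_div_mul_cancel hq.ne', ENNReal.rpow_one]

/-- The dual space decomposes in the `ℓ^q`-sense. -/
lemma dual [CompleteSpace E] (hP : LpDecomp P p) {q : ℝ} (hpq : p.HolderConjugate q) :
    LpDecomp (E := StrongDual ℂ E) (fun a => ContinuousLinearMap.precomp ℂ (P a)) q where
  idem a f := by ext u; simp [hP.idem]
  orth a b hab f := by ext u; simp [hP.orth _ _ hab.symm]
  tsum_enorm f := by
    simp only [ContinuousLinearMap.precomp_apply]
    have hq := hpq.symm.pos
    refine le_antisymm ?_ (hP.enorm_le_tsum_comp hpq f)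
    rw [ENNReal.tsum_eq_iSup_sum]
    refine iSup_le fun S => ?_
    simp only [← ofReal_norm, ENNReal.ofReal_rpow_of_nonneg (norm_nonneg _) hq.le]
    rw [← ENNReal.ofReal_sum_of_nonneg (fun a _ => by positivity)]
    exact ENNReal.ofReal_le_ofReal (hP.sum_norm_comp_rpow_le hpq f S)

/-! ### Compact operators and sequences which move to infinity -/

/-- Compact operators are approximated from the left by finite projections. -/
lemma tendsto_norm_comp_compact [CompleteSpace E] (hP : LpDecomp P p) (hp : 0 < p)
    {K : E →L[ℂ] E} (hK : IsCompactOperator K) :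
    Tendsto (fun a => ‖P a ∘L K‖) cofinite (𝓝 0) := by
  obtain ⟨Z, hZ, hKZ⟩ := hK.image_closedBall_subset_compact (f := (K : E →ₗ[ℂ] E)) 1
  rw [Metric.tendsto_nhds]
  intro ε hε
  -- A finite net of the image of the unit ball reduces the claim to single vectors, whose blocks
  -- tend to zero.
  obtain ⟨t, ht, htZ⟩ := Metric.totallyBounded_iff.1 hZ.totallyBounded (ε / 4) (by positivity)
  have hpt : ∀ y, ∀ᶠ a in cofinite, ‖P a y‖ < ε / 4 := by
    intro y
    have := (hP.hasSum hp y).summable.tendsto_cofinite_zero.norm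
    rw [norm_zero] at this
    exact this.eventually (gt_mem_nhds (by positivity))
  filter_upwards [(ht.eventually_all (l := cofinite)).2 fun y _ => hpt y] with a ha
  rw [dist_zero_right, norm_norm]
  refine lt_of_le_of_lt (ContinuousLinearMap.opNorm_le_of_unit_norm (C := ε / 2) (by positivity)
    fun u hu => ?_) (by linarith)
  have hmem : K u ∈ Z := hKZ ⟨u, by simp [hu], rfl⟩
  obtain ⟨y, hy, hyu⟩ := mem_iUnion₂.1 (htZ hmem)
  rw [Metric.mem_ball, dist_eq_norm] at hyu
  have h1 : P a (K u) = P a (K u - y) + P a y := by simp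
  calc ‖(P a ∘L K) u‖ = ‖P a (K u - y) + P a y‖ := by rw [← h1]; rfl
    _ ≤ ‖K u - y‖ + ‖P a y‖ := (norm_add_le _ _).trans (by gcongr; exact hP.norm_apply_le hp _ _)
    _ ≤ ε / 2 := by linarith [ha y hy]

/-- The pieces of `f` are the blocks of a convergent sum in the dual decomposition. This needs `1 <
p`: the functional `x ↦ ∑ x i` on `ℓ^1` violates the conclusion. -/
lemma tendsto_norm_functional_comp [CompleteSpace E] (hP : LpDecomp P p) (hp : 1 < p)
    (f : StrongDual ℂ E) : Tendsto (fun a => ‖f ∘L P a‖) cofinite (𝓝 0) := by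
  have hpq := Real.HolderConjugate.conjExponent hp
  have h := ((hP.dual hpq).hasSum hpq.symm.pos f).summable.tendsto_cofinite_zero.norm
  simpa using h

/-- A compact operator maps bounded sequences which move to infinity to null sequences. -/
lemma tendsto_compact_apply [CompleteSpace E] (hP : LpDecomp P p) (hp : 1 < p)
    {K : E →L[ℂ] E} (hK : IsCompactOperator K) {b : ℕ → ι} (hb : Tendsto b atTop cofinite)
    {w : ℕ → E} (hw : ∀ m, P (b m) (w m) = w m) {C : ℝ} (hC : ∀ m, ‖w m‖ ≤ C) :
    Tendsto (fun m => ‖K (w m)‖) atTop (𝓝 0) := by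
  obtain ⟨Z, hZ, hKZ⟩ := hK.image_closedBall_subset_compact (f := (K : E →ₗ[ℂ] E)) C
  -- The sequence `w` converges weakly to zero, because `f` sees `w m` only through its piece at `b
  -- m`.
  have hweak : ∀ f : StrongDual ℂ E, Tendsto (fun m => f (w m)) atTop (𝓝 0) := by
    intro f
    refine squeeze_zero_norm (a := fun m => ‖f ∘L P (b m)‖ * C) (fun m => ?_) ?_
    · calc ‖f (w m)‖ = ‖(f ∘L P (b m)) (w m)‖ := by simp [hw]
        _ ≤ ‖f ∘L P (b m)‖ * C := (ContinuousLinearMap.le_opNorm _ _).trans (by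
            gcongr; exact hC m)
    · simpa using ((hP.tendsto_norm_functional_comp hp f).comp hb).mul_const C
  rw [← tendsto_zero_iff_norm_tendsto_zero]
  -- The images stay in a compact set, and any cluster point is annihilated by all functionals.
  refine hZ.tendsto_nhds_of_unique_mapClusterPt
    (Eventually.of_forall fun m => hKZ ⟨w m, by simpa using hC m, rfl⟩) fun y _ hy => ?_
  refine SeparatingDual.eq_zero_of_forall_dual_eq_zero (R := ℂ) fun f => ?_
  have h1 : MapClusterPt (f y) atTop (fun m => f (K (w m))) :=
    hy.continuousAt_comp f.continuous.continuousAt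
  have h2 : Tendsto (fun m => f (K (w m))) atTop (𝓝 0) := hweak (f ∘L K)
  exact eq_of_nhds_neBot (h1.clusterPt.mono h2).neBot

end LpDecomp

/-! ### Localization of lower norms -/

/-- Minkowski's inequality for the counting measure. -/
lemma ENNReal.Lp_add_le_tsum {ι : Type*} (f g : ι → ℝ≥0∞) {p : ℝ} (hp : 1 ≤ p) :
    (∑' i, (f i + g i) ^ p) ^ (1 / p) ≤
      (∑' i, f i ^ p) ^ (1 / p) + (∑' i, g i ^ p) ^ (1 / p) := by
  let _ : MeasurableSpace ι := ⊤
  have h := ENNReal.lintegral_Lp_add_le (μ := Measure.count) (f := f) (g := g)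
    measurable_from_top.aemeasurable measurable_from_top.aemeasurable hp
  simpa only [lintegral_count, Pi.add_apply] using h

/-- Existence of finite sets which are almost invariant under finitely many translations. -/
def HasFolnerSets (G : Type*) [AddCommGroup G] [DecidableEq G] : Prop :=
  ∀ (F : Finset G) (ε : ℝ), 0 < ε → ∃ B : Finset G, B.Nonempty ∧
    ∀ β ∈ F, ((symmDiff B (B.image (· + β))).card : ℝ) ≤ ε * B.card

/-- The abstract Wiener algebra: the suprema over the diagonals of the matrix are summable. -/
def IsWiener {G E : Type*} [AddCommGroup G] [NormedAddCommGroup E] [NormedSpace ℂ E]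
    (P : G → E →L[ℂ] E) (A : E →L[ℂ] E) : Prop :=
  ∑' β : G, ⨆ α : G, ‖P α ∘L A ∘L P (α - β)‖ₑ < ∞

/-- Double counting: every index lies in exactly `Δ.card` translates of `Δ`. -/
lemma tsum_tsum_translate {G : Type*} [AddCommGroup G] [DecidableEq G] (Δ : Finset G)
    (c : G → ℝ≥0∞) :
    ∑' h, ∑' a, (if a - h ∈ Δ then c a else 0) = Δ.card * ∑' a, c a := by
  rw [ENNReal.tsum_comm, ← ENNReal.tsum_mul_left]
  refine tsum_congr fun a => ?_
  rw [← (Equiv.subLeft a).tsum_eq (fun h => if a - h ∈ Δ then c a else 0)]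
  simp only [Equiv.subLeft_apply, sub_sub_cancel]
  rw [tsum_eq_sum (s := Δ) (fun b hb => if_neg hb), Finset.sum_congr rfl (fun b hb => if_pos hb)]
  simp

namespace LpDecomp

variable {G E : Type*} [AddCommGroup G] [NormedAddCommGroup E] [NormedSpace ℂ E]
  {P : G → E →L[ℂ] E} {p : ℝ}

/-- Approximation of an operator in the Wiener algebra by finite sums of diagonals. -/
lemma exists_band_approx [CompleteSpace E] (hP : LpDecomp P p) (hp : 0 < p) {A : E →L[ℂ] E}
    (hA : IsWiener P A) {δ : ℝ} (hδ : 0 < δ) :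
    ∃ (F : Finset G) (T : G → E →L[ℂ] E),
      (∀ β a u, P a (T β u) = P a (T β (P (a - β) u))) ∧ ‖A - ∑ β ∈ F, T β‖ < δ := by
  set s : G → ℝ≥0∞ := fun β => ⨆ α : G, ‖P α ∘L A ∘L P (α - β)‖ₑ with hs
  have hsum : ∑' β, s β ≠ ∞ := hA.ne
  have hT : ∀ β, ∃ B : E →L[ℂ] E, (∀ a u, P a (B u) = P a (A (P (a - β) u))) ∧
      ‖B‖ ≤ (s β).toReal := fun β =>
    hP.exists_blockOp hp (fun _ => A) (σ := fun a => a - β) sub_left_injective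
      ENNReal.toReal_nonneg fun a => by
        rw [← toReal_enorm]
        exact ENNReal.toReal_mono (ENNReal.ne_top_of_tsum_ne_top hsum β)
          (le_iSup (fun α => ‖P α ∘L A ∘L P (α - β)‖ₑ) a)
  choose T hT hTn using hT
  have hTs : Summable T := Summable.of_norm_bounded (ENNReal.summable_toReal hsum) hTn
  -- The diagonals `T β` are absolutely summable; their sum has the same blocks as `A`, as the
  -- substitution of `a - β` for the column index shows.
  have hTA : HasSum T A := by
    convert hTs.hasSum
    ext u
    refine hP.ext hp fun a => ?_
    have h1 : HasSum (fun β => P a (T β u)) (P a ((∑' β, T β) u)) :=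
      ((P a).hasSum ((ContinuousLinearMap.apply ℂ E u).hasSum hTs.hasSum))
    have h2 : HasSum (fun β => P a (T β u)) (P a (A u)) := by
      simp only [hT]
      exact (Equiv.subLeft a).hasSum_iff.2 ((P a ∘L A).hasSum (hP.hasSum hp u))
    exact h2.unique h1
  have := (Metric.tendsto_nhds.1 hTA δ hδ).exists
  obtain ⟨F, hF⟩ := this
  refine ⟨F, T, fun β a u => by rw [hT, hT, hP.idem], ?_⟩
  rwa [dist_comm, dist_eq_norm] at hF

variable [DecidableEq G]

/-- The finite projection which corresponds to the translate `h + B`. -/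
def transProj (P : G → E →L[ℂ] E) (B : Finset G) (h : G) : E →L[ℂ] E :=
  finProj P (B.image (h + ·))

lemma apply_transProj (hP : LpDecomp P p) (B : Finset G) (h a : G) (u : E) :
    P a (transProj P B h u) = if a - h ∈ B then P a u else 0 := by
  have : a ∈ B.image (h + ·) ↔ a - h ∈ B := by
    rw [Finset.mem_image]
    constructor
    · rintro ⟨b, hb, rfl⟩; simpa using hb
    · intro hb; exact ⟨_, hb, by abel⟩
  rw [transProj, hP.apply_finProj]
  simp only [this]

lemma tsum_enorm_transProj (hP : LpDecomp P p) (hp : 0 < p) (B : Finset G) (u : E) :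
    ∑' h, ‖transProj P B h u‖ₑ ^ p = B.card * ‖u‖ₑ ^ p := by
  rw [← hP.tsum_enorm u, ← tsum_tsum_translate]
  refine tsum_congr fun h => ?_
  rw [← hP.tsum_enorm]
  refine tsum_congr fun a => ?_
  rw [hP.apply_transProj]
  split_ifs
  · rfl
  · rw [enorm_zero, ENNReal.zero_rpow_of_pos hp]

/-- As `T` has only the diagonal `β`, block `a` of the commutator is block `a` of `T u` times the
difference of the indicators of `a - β - h ∈ B` and `a - h ∈ B`. This difference has modulus one
exactly when `a - h` lies in the symmetric difference, and double counting applies. -/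
lemma tsum_enorm_commutator (hP : LpDecomp P p) (hp : 0 < p) (B : Finset G) {β : G}
    {T : E →L[ℂ] E} (hT : ∀ a u, P a (T u) = P a (T (P (a - β) u))) (u : E) :
    ∑' h, ‖T (transProj P B h u) - transProj P B h (T u)‖ₑ ^ p =
      (symmDiff B (B.image (· + β))).card * ‖T u‖ₑ ^ p := by
  rw [← hP.tsum_enorm (T u), ← tsum_tsum_translate]
  refine tsum_congr fun h => ?_
  rw [← hP.tsum_enorm]
  refine tsum_congr fun a => ?_
  rw [map_sub, hP.apply_transProj, hT, hP.apply_transProj]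
  have h1 : a - h ∈ B.image (· + β) ↔ a - β - h ∈ B := by
    rw [Finset.mem_image]
    constructor
    · rintro ⟨b, hb, h2⟩
      rw [sub_right_comm, ← h2]; simpa using hb
    · intro hb; exact ⟨_, hb, by abel⟩
  simp only [Finset.mem_symmDiff, h1]
  by_cases h2 : a - β - h ∈ B <;> by_cases h3 : a - h ∈ B <;>
    simp [h2, h3, ENNReal.zero_rpow_of_pos hp, ← hT a u]

/-- Lower norms are attained, up to a small error, on vectors which are supported in translates
of a fixed finite set. -/
lemma exists_localization [CompleteSpace E] (hP : LpDecomp P p) (hp : 1 ≤ p)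
    (hG : HasFolnerSets G) {A : E →L[ℂ] E} (hA : IsWiener P A) {δ : ℝ} (hδ : 0 < δ) :
    ∃ B : Finset G, ∀ u ≠ 0, ∀ r : ℝ, 0 ≤ r → ‖A u‖ ≤ r * ‖u‖ →
      ∃ h, transProj P B h u ≠ 0 ∧
        ‖A (transProj P B h u)‖ ≤ (r + δ) * ‖transProj P B h u‖ := by
  have hp0 : 0 < p := by linarith
  obtain ⟨F, T, hT, hAT⟩ := hP.exists_band_approx hp0 hA (δ := δ / 4) (by positivity)
  set S := ∑ β ∈ F, T β with hS
  -- The power `p - 1` comes from the power mean inequality for a sum over `F`.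
  set M : ℝ := (F.card : ℝ) ^ (p - 1) * ∑ β ∈ F, ‖T β‖ ^ p with hM
  have hM0 : 0 ≤ M := by positivity
  -- With this tolerance the `p`-th powers of all commutators with `S` add up to at most `B.card *
  -- (δ / 4 * ‖u‖) ^ p`; the summand `1` avoids division by zero.
  obtain ⟨B, hB, hBF⟩ := hG F ((δ / 4) ^ p / (M + 1)) (by positivity)
  refine ⟨B, fun u hu r hr hur => ?_⟩
  by_contra! hcon
  have hcard : (0 : ℝ) < B.card := by exact_mod_cast hB.card_pos
  have hun : 0 < ‖u‖ := norm_pos_iff.2 hu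
  have hSA : ∀ v, ‖S v‖ ≤ ‖A v‖ + δ / 4 * ‖v‖ ∧ ‖A v‖ ≤ ‖S v‖ + δ / 4 * ‖v‖ := by
    intro v
    have h1 := (A - S).le_of_opNorm_le hAT.le v
    rw [_root_.sub_apply] at h1
    exact ⟨by linarith [norm_sub_norm_le (S v) (A v), norm_sub_rev (S v) (A v)],
      by linarith [norm_sub_norm_le (A v) (S v)]⟩
  -- If localization fails on every translate, then `S` inherits the lower bound `r + δ` with loss
  -- `δ / 4`.
  have hlow : ∀ h, ENNReal.ofReal (r + δ * 3 / 4) * ‖transProj P B h u‖ₑ ≤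
      ‖transProj P B h (S u)‖ₑ + ‖S (transProj P B h u) - transProj P B h (S u)‖ₑ := by
    intro h
    set v := transProj P B h u with hv
    have h1 : (r + δ * 3 / 4) * ‖v‖ ≤ ‖S v‖ := by
      by_cases h0 : v = 0
      · simp [h0]
      · linarith [(hSA v).2, hcon h h0]
    have h2 : (r + δ * 3 / 4) * ‖v‖ ≤ ‖transProj P B h (S u)‖ + ‖S v - transProj P B h (S u)‖ :=
      h1.trans (by simpa using norm_add_le (transProj P B h (S u)) (S v - transProj P B h (S u)))
    simp only [← ofReal_norm]
    rw [← ENNReal.ofReal_mul (by positivity), ← ENNReal.ofReal_add (by positivity) (by positivity)]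
    exact ENNReal.ofReal_le_ofReal h2
  have hcomm : ∑' h, ‖S (transProj P B h u) - transProj P B h (S u)‖ₑ ^ p ≤
      B.card * ENNReal.ofReal (δ / 4 * ‖u‖) ^ p := by
    calc ∑' h, ‖S (transProj P B h u) - transProj P B h (S u)‖ₑ ^ p
        ≤ ∑' h, ∑ β ∈ F, (F.card : ℝ≥0∞) ^ (p - 1) *
            ‖T β (transProj P B h u) - transProj P B h (T β u)‖ₑ ^ p := by
          refine ENNReal.tsum_le_tsum fun h => ?_
          rw [← Finset.mul_sum]
          refine le_trans (ENNReal.rpow_le_rpow ?_ hp0.le)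
            (ENNReal.rpow_sum_le_const_mul_sum_rpow F _ hp)
          have : S (transProj P B h u) - transProj P B h (S u) =
              ∑ β ∈ F, (T β (transProj P B h u) - transProj P B h (T β u)) := by
            simp [hS, Finset.sum_sub_distrib]
          rw [this]
          exact enorm_sum_le _ _
      _ = ∑ β ∈ F, (F.card : ℝ≥0∞) ^ (p - 1) *
            ((symmDiff B (B.image (· + β))).card * ‖T β u‖ₑ ^ p) := by
          rw [Summable.tsum_finsetSum (fun _ _ => ENNReal.summable)]
          refine Finset.sum_congr rfl fun β _ => ?_
          rw [ENNReal.tsum_mul_left, hP.tsum_enorm_commutator hp0 B (hT β)]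
      _ ≤ ∑ β ∈ F, ENNReal.ofReal ((F.card : ℝ) ^ (p - 1) *
            ((δ / 4) ^ p / (M + 1) * B.card * (‖T β‖ ^ p * ‖u‖ ^ p))) := by
          refine Finset.sum_le_sum fun β hβ => ?_
          rw [ENNReal.ofReal_mul (by positivity), ENNReal.ofReal_mul (by positivity),
            ← ENNReal.ofReal_rpow_of_nonneg (by positivity) (by linarith), ENNReal.ofReal_natCast]
          gcongr
          · rw [← ENNReal.ofReal_natCast]
            exact ENNReal.ofReal_le_ofReal (hBF β hβ)
          · rw [← Real.mul_rpow (by positivity) (by positivity),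
              ← ENNReal.ofReal_rpow_of_nonneg (by positivity) hp0.le, ← ofReal_norm]
            gcongr
            exact (T β).le_opNorm u
      _ = ENNReal.ofReal (B.card * (δ / 4 * ‖u‖) ^ p * (M / (M + 1))) := by
          rw [← ENNReal.ofReal_sum_of_nonneg (fun _ _ => by positivity), hM,
            Real.mul_rpow (by positivity) (by positivity)]
          congr 1
          simp only [Finset.mul_sum, Finset.sum_div]
          refine Finset.sum_congr rfl fun β _ => ?_
          ring
      _ ≤ B.card * ENNReal.ofReal (δ / 4 * ‖u‖) ^ p := by
          rw [ENNReal.ofReal_rpow_of_nonneg (by positivity) hp0.le, ← ENNReal.ofReal_natCast,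
            ← ENNReal.ofReal_mul (by positivity)]
          refine ENNReal.ofReal_le_ofReal (mul_le_of_le_one_right (by positivity) ?_)
          rw [div_le_one (by positivity)]
          linarith
  have hroot : ∀ x : ℝ≥0∞, (B.card * x ^ p) ^ (1 / p) = (B.card : ℝ≥0∞) ^ (1 / p) * x := fun x => by
    rw [ENNReal.mul_rpow_of_nonneg _ _ (by positivity), ← ENNReal.rpow_mul,
      mul_one_div_cancel hp0.ne', ENNReal.rpow_one]
  have hN0 : (B.card : ℝ≥0∞) ^ (1 / p) ≠ 0 := by
    rw [Ne, ENNReal.rpow_eq_zero_iff_of_pos (by positivity)]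
    exact_mod_cast hB.card_pos.ne'
  have hNtop : (B.card : ℝ≥0∞) ^ (1 / p) ≠ ∞ :=
    ENNReal.rpow_ne_top_of_nonneg (by positivity) (by simp)
  -- The `ℓ^p`-norm over all translates `h` is taken on both sides of `hlow`. The outcome `r + 3δ/4
  -- ≤ (r + δ/4) + δ/4` is absurd.
  have hfin : (B.card : ℝ≥0∞) ^ (1 / p) * (ENNReal.ofReal (r + δ * 3 / 4) * ‖u‖ₑ) ≤
      (B.card : ℝ≥0∞) ^ (1 / p) * (‖S u‖ₑ + ENNReal.ofReal (δ / 4 * ‖u‖)) := by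
    rw [← hroot, mul_add, ← hroot, ← hroot, ENNReal.mul_rpow_of_nonneg _ _ hp0.le,
      mul_left_comm, ← hP.tsum_enorm_transProj hp0 B u, ← hP.tsum_enorm_transProj hp0 B (S u),
      ← ENNReal.tsum_mul_left]
    refine le_trans ?_ ((ENNReal.Lp_add_le_tsum (fun h => ‖transProj P B h (S u)‖ₑ)
      (fun h => ‖S (transProj P B h u) - transProj P B h (S u)‖ₑ) hp).trans ?_)
    · gcongr with h
      rw [← ENNReal.mul_rpow_of_nonneg _ _ hp0.le]
      exact ENNReal.rpow_le_rpow (hlow h) hp0.le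
    · gcongr
  rw [ENNReal.mul_le_mul_iff_right hN0 hNtop, ← ofReal_norm, ← ofReal_norm,
    ← ENNReal.ofReal_mul (by positivity), ← ENNReal.ofReal_add (by positivity) (by positivity),
    ENNReal.ofReal_le_ofReal_iff (by positivity)] at hfin
  nlinarith [(hSA u).1]

lemma apply_transProj_ne_zero (hP : LpDecomp P p) {B : Finset G} {h a : G} {u : E}
    (ha : P a (transProj P B h u) ≠ 0) : a - h ∈ B ∧ P a u ≠ 0 := by
  rw [hP.apply_transProj] at ha
  split_ifs at ha with hB
  · exact ⟨hB, ha⟩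
  · exact (ha rfl).elim

/-- Successive localization: there is a point around which a vector can be localized at many
scales simultaneously. -/
lemma exists_multiscale_localization (hP : LpDecomp P p) (hp : 0 < p) {A : E →L[ℂ] E}
    (B : ℕ → Finset G)
    (hB : ∀ j, ∀ u ≠ 0, ∀ r : ℝ, 0 ≤ r → ‖A u‖ ≤ r * ‖u‖ →
      ∃ h, transProj P (B j) h u ≠ 0 ∧
        ‖A (transProj P (B j) h u)‖ ≤ (r + (1 / 2) ^ j) * ‖transProj P (B j) h u‖) (m : ℕ) :
    ∀ u ≠ 0, ∀ r : ℝ, 0 ≤ r → ‖A u‖ ≤ r * ‖u‖ →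
      ∃ x, P x u ≠ 0 ∧ ∀ j < m, ∃ v ≠ 0,
        (∀ a, P a v ≠ 0 → a - x ∈ Finset.image₂ (· - ·) (B j) (B j)) ∧
        ‖A v‖ ≤ (r + 2 * (1 / 2) ^ j - 2 * (1 / 2) ^ m) * ‖v‖ := by
  -- Scales are treated from the largest index down to `0`, each time cutting the previously cut
  -- vector. The loss up to scale `j` is the geometric sum of `(1 / 2) ^ i` over `j ≤ i < m`, which
  -- is `2 * (1 / 2) ^ j - 2 * (1 / 2) ^ m`.
  induction m with
  | zero =>
    intro u hu r _ _
    obtain ⟨x, hx⟩ := hP.exists_apply_ne_zero hp hu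
    exact ⟨x, hx, fun j hj => (Nat.not_lt_zero j hj).elim⟩
  | succ m ih =>
    intro u hu r hr hur
    obtain ⟨h, hv, hvr⟩ := hB m u hu r hr hur
    obtain ⟨x, hx, H⟩ := ih _ hv _ (by positivity) hvr
    obtain ⟨hxB, hxu⟩ := hP.apply_transProj_ne_zero hx
    refine ⟨x, hxu, fun j hj => ?_⟩
    rcases (Nat.lt_succ_iff_lt_or_eq.1 hj) with hj | rfl
    · obtain ⟨v, hv0, hvs, hvA⟩ := H j hj
      refine ⟨v, hv0, hvs, hvA.trans (le_of_eq ?_)⟩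
      rw [pow_succ]; ring
    -- The final point `x` survives all cuts, so at scale `j` both `a` and `x` lie in the same
    -- translate of `B j`, and `a - x` lies in the difference set.
    · refine ⟨_, hv, fun a ha => ?_, hvr.trans (le_of_eq ?_)⟩
      · obtain ⟨haB, -⟩ := hP.apply_transProj_ne_zero ha
        exact Finset.mem_image₂.2 ⟨_, haB, _, hxB, by abel⟩
      · rw [pow_succ]; ring

end LpDecomp

/-! ### Shifts and lower bounds at infinity -/

/-- Isometric shifts which are compatible with the decomposition. -/
structure IsShiftFamily {G E : Type*} [AddCommGroup G] [NormedAddCommGroup E] [NormedSpace ℂ E]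
    (P : G → E →L[ℂ] E) (V : G → E →L[ℂ] E) : Prop where
  norm_map : ∀ g u, ‖V g u‖ = ‖u‖
  neg_apply : ∀ g u, V (-g) (V g u) = u
  map_proj : ∀ g a u, V g (P a u) = P (a + g) (V g u)

namespace IsShiftFamily

variable {G E : Type*} [AddCommGroup G] [NormedAddCommGroup E] [NormedSpace ℂ E]
  {P : G → E →L[ℂ] E} {V : G → E →L[ℂ] E}

lemma apply_neg (hV : IsShiftFamily P V) (g : G) (u : E) : V g (V (-g) u) = u := by
  simpa using hV.neg_apply (-g) u

lemma proj_apply (hV : IsShiftFamily P V) (g a : G) (u : E) : P a (V g u) = V g (P (a - g) u) := by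
  rw [hV.map_proj, sub_add_cancel]

end IsShiftFamily

namespace LpDecomp

variable {G E : Type*} [AddCommGroup G] [NormedAddCommGroup E] [NormedSpace ℂ E]
  {P V : G → E →L[ℂ] E} {p : ℝ}

/-- If all limit operators are bounded below then the operator is bounded below at infinity. -/
theorem exists_lower_bound_at_infinity [CompleteSpace E] [Countable G] [DecidableEq G]
    (hP : LpDecomp P p) (hp : 1 ≤ p) (hG : HasFolnerSets G) (hV : IsShiftFamily P V)
    {A : E →L[ℂ] E} (hA : IsWiener P A)
    (hlim : ∀ h : ℕ → G, Tendsto h atTop cofinite → ∃ φ : ℕ → ℕ, StrictMono φ ∧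
      ∃ B : E →L[ℂ] E, (∀ S : Finset G, Tendsto
        (fun m => ‖(V (-h (φ m)) ∘L A ∘L V (h (φ m)) - B) ∘L finProj P S‖) atTop (𝓝 0)) ∧
        ∃ c > 0, ∀ u, c * ‖u‖ ≤ ‖B u‖) :
    ∃ S : Finset G, ∃ c > 0, ∀ u, finProj P S u = 0 → c * ‖u‖ ≤ ‖A u‖ := by
  have hp0 : 0 < p := by linarith
  by_contra! hcon
  choose B hB using fun j : ℕ =>
    hP.exists_localization hp hG hA (δ := (1 / 2) ^ j) (by positivity)
  obtain ⟨S, hSm, hS⟩ := exists_seq_monotone_tendsto_atTop_atTop (Finset G)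
  choose u hu0 hu using fun k : ℕ => hcon (S k) ((1 / 2) ^ k) (by positivity)
  have hune : ∀ k, u k ≠ 0 := fun k h0 => by simpa [h0] using hu k
  choose x hx hloc using fun k : ℕ => hP.exists_multiscale_localization hp0 B hB k (u k) (hune k)
    ((1 / 2) ^ k) (by positivity) (hu k).le
  -- The point `x k` belongs to the support of `u k`, which avoids `S k`.
  have hxinf : Tendsto x atTop cofinite := by
    refine le_cofinite_iff_eventually_ne.2 fun g => ?_
    rw [eventually_map]
    filter_upwards [hS.eventually_ge_atTop {g}] with k hk hxg
    have h1 := hP.apply_finProj (S k) (u k) (x k)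
    rw [hu0, map_zero, if_pos (hk (by simp [hxg]))] at h1
    exact hx k h1.symm
  obtain ⟨φ, hφ, L, hL, c, hc, hcL⟩ := hlim x hxinf
  -- The scale is fixed after `c` is known. The errors of localization and of the limit add up to
  -- less than `3 * (1 / 2) ^ j`, hence to less than `c`.
  obtain ⟨j, hj⟩ := exists_pow_lt_of_lt_one (show 0 < c / 4 by positivity)
    (show (1 / 2 : ℝ) < 1 by norm_num)
  set C := Finset.image₂ (· - ·) (B j) (B j) with hC
  have hLC := (hL C).eventually (gt_mem_nhds (show (0 : ℝ) < (1 / 2) ^ j by positivity))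
  obtain ⟨m, hm, hmj⟩ := (hLC.and (eventually_gt_atTop j)).exists
  have hjφ : j < φ m := lt_of_lt_of_le hmj (hφ.id_le m)
  obtain ⟨v, hv0, hvC, hvA⟩ := hloc (φ m) j hjφ
  -- Shifted back, the vector is supported in the set `C`, which does not depend on `m`; this is
  -- where the convergence to the limit operator can be used.
  set y := V (-x (φ m)) v with hy
  have hyC : finProj P C y = y := hP.finProj_eq_self hp0 fun a ha => by
    have h1 : P (a + x (φ m)) v ≠ 0 := fun h0 => ha (by
      rw [hy, hV.proj_apply, sub_neg_eq_add, h0, map_zero])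
    have h2 := hvC _ h1
    rwa [add_sub_cancel_right] at h2
  have hyn : ‖y‖ = ‖v‖ := hV.norm_map _ _
  have h1 : ‖(V (-x (φ m)) ∘L A ∘L V (x (φ m)) - L) y‖ ≤ (1 / 2) ^ j * ‖y‖ := by
    have := ((V (-x (φ m)) ∘L A ∘L V (x (φ m)) - L) ∘L finProj P C).le_of_opNorm_le hm.le y
    simpa [hyC] using this
  have h2 : (V (-x (φ m)) ∘L A ∘L V (x (φ m)) - L) y = V (-x (φ m)) (A v) - L y := by
    simp [hy, hV.apply_neg]
  have h3 : ‖L y‖ ≤ ‖A v‖ + (1 / 2) ^ j * ‖y‖ := by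
    rw [h2] at h1
    have := norm_sub_norm_le (L y) (V (-x (φ m)) (A v))
    rw [norm_sub_rev, hV.norm_map] at this
    linarith
  have h4 : (0 : ℝ) < ‖v‖ := norm_pos_iff.2 hv0
  have h5 : (1 / 2 : ℝ) ^ φ m ≤ (1 / 2) ^ j :=
    pow_le_pow_of_le_one (by norm_num) (by norm_num) hjφ.le
  have h6 := hcL y
  rw [hyn] at h3 h6
  have h7 : (0 : ℝ) < (1 / 2) ^ φ m := by positivity
  nlinarith

end LpDecomp

/-! ### Fredholm criteria -/

section Fredholm

variable {E F : Type*} [NormedAddCommGroup E] [NormedSpace ℂ E] [NormedAddCommGroup F]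
  [NormedSpace ℂ F]

/-- An operator with finite-dimensional kernel and cokernel between Banach spaces is Fredholm. -/
lemma ContinuousLinearMap.isFredholm_of_finite [CompleteSpace E] [CompleteSpace F] (A : E →L[ℂ] F)
    (hk : FiniteDimensional ℂ A.ker) (hc : A.range.CoFG) : A.IsFredholm := by
  obtain ⟨E₁, hE₁, hcompl⟩ :=
    (Submodule.ClosedComplemented.of_finiteDimensional A.ker).exists_isClosed_isCompl
  have hE₁c : E₁.CoFG := Submodule.FG.cofg_of_isCompl hcompl (Module.Finite.iff_fg.1 hk)
  have : CompleteSpace E₁ := hE₁.completeSpace_coe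
  set g : E₁ →L[ℂ] F := A ∘L E₁.subtypeL with hg
  have hgker : g.ker = ⊥ := by
    rw [LinearMap.ker_eq_bot']
    intro x hx
    have h1 : (x : E) ∈ A.ker ⊓ E₁ := ⟨hx, x.2⟩
    rw [hcompl.inf_eq_bot] at h1
    simpa using h1
  have hgrange : g.range = A.range := by
    refine le_antisymm ?_ ?_
    · rintro _ ⟨x, rfl⟩
      exact ⟨x, rfl⟩
    · rintro _ ⟨x, rfl⟩
      obtain ⟨y, hy, z, hz, rfl⟩ := Submodule.mem_sup.1
        (show x ∈ A.ker ⊔ E₁ by rw [hcompl.sup_eq_top]; trivial)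
      refine ⟨⟨z, hz⟩, ?_⟩
      have h0 : A y = 0 := hy
      simp [hg, h0]
  obtain ⟨Q, hQ⟩ := A.range.exists_isCompl
  have hQfin : FiniteDimensional ℂ Q := Module.Finite.iff_fg.2 (hc.fg_of_isCompl hQ)
  -- Restriction to a closed complement of the kernel makes the operator injective; its range has a
  -- finite-dimensional, hence closed, complement and is therefore closed.
  have hclosed : IsClosed (A.range : Set F) := by
    rw [← hgrange]
    exact g.closed_complemented_range_of_isCompl_of_ker_eq_bot Q (by rw [hgrange]; exact hQ)
      Q.closed_of_finiteDimensional hgker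
  have : CompleteSpace A.range := hclosed.completeSpace_coe
  have hm : MapsTo A E₁ A.range := fun x _ => ⟨x, rfl⟩
  refine ContinuousLinearMap.IsFredholm.of_isInvertible_restrict hE₁ hclosed hm
    ⟨ContinuousLinearEquiv.ofBijective (A.restrict hm) ?_ ?_, ?_⟩
  · rw [LinearMap.ker_eq_bot']
    intro x hx
    exact (LinearMap.ker_eq_bot'.1 hgker) x (congrArg Subtype.val hx)
  · rw [LinearMap.range_eq_top]
    rintro ⟨y, hy⟩
    rw [← hgrange] at hy
    obtain ⟨x, rfl⟩ := hy
    exact ⟨x, rfl⟩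
  · exact ContinuousLinearEquiv.coe_ofBijective _ _ _

/-- On the kernel the norm is controlled by the compact operators alone. Jointly they form a closed
embedding, so zero has a compact neighborhood in the kernel. -/
lemma finiteDimensional_ker_of_le_compact [CompleteSpace E] (A : E →L[ℂ] F) {ι : Type*}
    (s : Finset ι) (K : ι → E →L[ℂ] E) (hK : ∀ j ∈ s, IsCompactOperator (K j)) {C : ℝ}
    (h : ∀ u, ‖u‖ ≤ C * ‖A u‖ + ∑ j ∈ s, ‖K j u‖) : FiniteDimensional ℂ A.ker := by
  have : CompleteSpace A.ker := (ContinuousLinearMap.isClosed_ker A).completeSpace_coe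
  let T : A.ker →L[ℂ] (s → E) := ContinuousLinearMap.pi fun j => K j ∘L A.ker.subtypeL
  have hT : AntilipschitzWith (s.card : NNReal) T := by
    refine AddMonoidHomClass.antilipschitz_of_bound T fun x => ?_
    have h1 := h x
    have h2 : A (x : E) = 0 := x.2
    rw [h2, norm_zero, mul_zero, zero_add, ← Finset.sum_coe_sort] at h1
    refine h1.trans ((Finset.sum_le_card_nsmul _ _ ‖T x‖ fun j _ => norm_le_pi_norm (T x) j).trans ?_)
    simp
  refine FiniteDimensional.of_isCompactOperator_id (𝕜 := ℂ) ?_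
  choose Z hZ hKZ using fun j : s => hK j j.2
  refine ⟨T ⁻¹' (pi univ Z), (hT.isClosedEmbedding T.uniformContinuous).isCompact_preimage
    (isCompact_univ_pi hZ), ?_⟩
  have h3 : ∀ j : s, (K j ∘L A.ker.subtypeL) ⁻¹' Z j ∈ 𝓝 (0 : A.ker) := fun j =>
    A.ker.subtypeL.continuous.continuousAt.preimage_mem_nhds (by
      rw [map_zero]; exact hKZ j)
  filter_upwards [Filter.eventually_all.2 h3] with x hx j _ using hx j

/-- A compact operator is dominated on functionals by finitely many evaluations. -/
lemma IsCompactOperator.exists_functional_bound {K : E →L[ℂ] F} (hK : IsCompactOperator K)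
    {ε : ℝ} (hε : 0 < ε) : ∃ t : Finset F, ∀ f : StrongDual ℂ F,
      ‖f ∘L K‖ ≤ ∑ y ∈ t, ‖f y‖ + ε * ‖f‖ := by
  obtain ⟨Z, hZ, hKZ⟩ := hK.image_closedBall_subset_compact (f := (K : E →ₗ[ℂ] F)) 1
  obtain ⟨t, ht, htZ⟩ := Metric.totallyBounded_iff.1 hZ.totallyBounded ε hε
  refine ⟨ht.toFinset, fun f => ?_⟩
  refine ContinuousLinearMap.opNorm_le_of_unit_norm
    (add_nonneg (Finset.sum_nonneg fun _ _ => norm_nonneg _) (by positivity)) fun u hu => ?_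
  have hmem : K u ∈ Z := hKZ ⟨u, by simp [hu], rfl⟩
  obtain ⟨y, hy, hyu⟩ := mem_iUnion₂.1 (htZ hmem)
  rw [Metric.mem_ball, dist_eq_norm] at hyu
  have h1 : (f ∘L K) u = f y + f (K u - y) := by simp
  rw [h1]
  refine (norm_add_le _ _).trans (add_le_add ?_ ?_)
  · exact Finset.single_le_sum (f := fun y => ‖f y‖) (fun _ _ => norm_nonneg _)
      (by simpa using hy)
  · rw [mul_comm]
    exact (f.le_opNorm _).trans (by gcongr)

/-- Hahn–Banach: if `y` is not in the closure of the image of the ball of radius `R = c⁻¹ * ‖y‖`, a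
separating `f` satisfies `‖f ∘L A‖ * R < ‖f‖ * ‖y‖ = c * ‖f‖ * R`, contrary to the lower bound. -/
lemma exists_approx_preimage_of_dual_lower_bound (A : E →L[ℂ] F) {c : ℝ} (hc : 0 < c)
    (h : ∀ f : StrongDual ℂ F, c * ‖f‖ ≤ ‖f ∘L A‖) (y : F) :
    ∃ x, ‖x‖ ≤ c⁻¹ * ‖y‖ ∧ ‖y - A x‖ ≤ 1 / 2 * ‖y‖ := by
  rcases eq_or_ne y 0 with rfl | hy
  · exact ⟨0, by simp, by simp⟩
  have hy' : 0 < ‖y‖ := norm_pos_iff.2 hy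
  set R := c⁻¹ * ‖y‖ with hR
  have hR0 : 0 < R := by positivity
  have hcl : y ∈ closure (A '' Metric.closedBall 0 R) := by
    by_contra hcon
    have hconv : Convex ℝ (closure (A '' Metric.closedBall 0 R)) :=
      ((convex_closedBall (0 : E) R).is_linear_image (f := fun x => A x)
        (A.restrictScalars ℝ).toLinearMap.isLinear).closure
    obtain ⟨f, s, hs, hsy⟩ := RCLike.geometric_hahn_banach_closed_point (𝕜 := ℂ) hconv
      isClosed_closure hcon
    have hb : ∀ x : E, ‖x‖ ≤ R → ‖f (A x)‖ ≤ s := by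
      intro x hx
      by_cases hz : f (A x) = 0
      · have := hs (A 0) (subset_closure ⟨0, by simp [hR0.le], rfl⟩)
        simp at this
        rw [hz, norm_zero]
        exact this.le
      · set a : ℂ := ‖f (A x)‖ / f (A x) with ha
        have ha1 : ‖a‖ = 1 := by
          rw [ha, norm_div, Complex.norm_real, norm_norm, div_self (norm_ne_zero_iff.2 hz)]
        have h1 := hs (A (a • x)) (subset_closure ⟨a • x, by simp [norm_smul, ha1, hx], rfl⟩)
        rw [map_smul, map_smul, smul_eq_mul, ha, div_mul_cancel₀ _ hz] at h1
        simpa using h1.le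
    have h2 : ‖f ∘L A‖ ≤ s / R := by
      have hs0 : 0 ≤ s := (norm_nonneg _).trans (hb 0 (by simp [hR0.le]))
      refine ContinuousLinearMap.opNorm_le_of_unit_norm (by positivity) fun x hx => ?_
      have h3 := hb ((R : ℂ) • x) (by simp [norm_smul, hx, abs_of_pos hR0])
      rw [map_smul, map_smul, norm_smul, Complex.norm_real, Real.norm_of_nonneg hR0.le] at h3
      rw [le_div_iff₀ hR0, mul_comm]
      exact h3
    have h4 : s < ‖f‖ * ‖y‖ :=
      hsy.trans_le ((Complex.re_le_norm _).trans (f.le_opNorm y))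
    have h5 := (h f).trans h2
    rw [le_div_iff₀ hR0, hR] at h5
    have h6 : c * ‖f‖ * (c⁻¹ * ‖y‖) = ‖f‖ * ‖y‖ := by field_simp
    linarith
  obtain ⟨_, ⟨x, hx, rfl⟩, hxy⟩ := Metric.mem_closure_iff.1 hcl (1 / 2 * ‖y‖) (by positivity)
  exact ⟨x, by simpa using hx, by rw [← dist_eq_norm]; exact hxy.le⟩

/-- An operator whose adjoint is bounded below is onto. -/
lemma surjective_of_dual_lower_bound [CompleteSpace E] (A : E →L[ℂ] F) {c : ℝ} (hc : 0 < c)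
    (h : ∀ f : StrongDual ℂ F, c * ‖f‖ ≤ ‖f ∘L A‖) : Function.Surjective A := by
  choose g hg hgA using exists_approx_preimage_of_dual_lower_bound A hc h
  intro y
  -- Successive approximation: every step halves the remainder, so the corrections form a summable
  -- series.
  set H : F → F := fun y => y - A (g y) with hH
  have hn : ∀ n : ℕ, ‖H^[n] y‖ ≤ (1 / 2) ^ n * ‖y‖ := by
    intro n
    induction n with
    | zero => simp
    | succ n ih =>
      rw [Function.iterate_succ_apply', pow_succ']
      refine (hgA _).trans ?_
      linarith
  have hs : Summable fun n : ℕ => g (H^[n] y) := by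
    refine Summable.of_norm_bounded (g := fun n : ℕ => c⁻¹ * ((1 / 2 : ℝ) ^ n * ‖y‖))
      ((summable_geometric_two.mul_right _).mul_left _) fun n => (hg _).trans ?_
    gcongr
    exact hn n
  have hsum : ∀ n : ℕ, A (∑ i ∈ Finset.range n, g (H^[i] y)) = y - H^[n] y := by
    intro n
    induction n with
    | zero => simp
    | succ n ih =>
      rw [Finset.sum_range_succ, map_add, ih, Function.iterate_succ_apply']
      simp only [hH]
      abel
  refine ⟨∑' n, g (H^[n] y), ?_⟩
  have h1 : Tendsto (fun n => A (∑ i ∈ Finset.range n, g (H^[i] y))) atTop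
      (𝓝 (A (∑' n, g (H^[n] y)))) := (A.continuous.tendsto _).comp hs.hasSum.tendsto_sum_nat
  have h2 : Tendsto (fun n : ℕ => H^[n] y) atTop (𝓝 0) := by
    refine squeeze_zero_norm hn ?_
    simpa using (tendsto_pow_atTop_nhds_zero_of_lt_one (by norm_num : (0 : ℝ) ≤ 1 / 2)
      (by norm_num)).mul_const ‖y‖
  simp only [hsum] at h1
  exact tendsto_nhds_unique h1 (by simpa using tendsto_const_nhds.sub h2)

/-- On functionals the compact terms are dominated by evaluations at finitely many vectors, up to a
small multiple of the norm. Adjoining these vectors to the range of `A` gives an operator whose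
adjoint is bounded below; it is onto, so the added vectors span the quotient by the range. -/
lemma cofg_range_of_dual_le_compact [CompleteSpace E] (A : E →L[ℂ] F) {ι : Type*}
    (s : Finset ι) (K : ι → F →L[ℂ] F) (hK : ∀ j ∈ s, IsCompactOperator (K j)) {C : ℝ}
    (h : ∀ f : StrongDual ℂ F, ‖f‖ ≤ C * ‖f ∘L A‖ + ∑ j ∈ s, ‖f ∘L K j‖) : A.range.CoFG := by
  classical
  -- Over all `j ∈ s` these errors amount to at most `‖f‖ / 2`, which is absorbed on the left.
  have hcard : (0 : ℝ) < 1 / (2 * (s.card + 1)) := by positivity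
  choose t ht using fun j : s => (hK j j.2).exists_functional_bound hcard
  set t' : Finset F := s.attach.biUnion t with ht'
  have hbound : ∀ f : StrongDual ℂ F,
      ‖f‖ ≤ 2 * C * ‖f ∘L A‖ + 2 * s.card * ∑ y ∈ t', ‖f y‖ := by
    intro f
    have h1 : ∀ j ∈ s.attach, ‖f ∘L K j‖ ≤ ∑ y ∈ t', ‖f y‖ + 1 / (2 * (s.card + 1)) * ‖f‖ :=
      fun j hj => (ht j f).trans (by
        gcongr
        exact Finset.subset_biUnion_of_mem t hj)
    have h2 := Finset.sum_le_card_nsmul _ _ _ h1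
    rw [Finset.sum_attach s (fun j => ‖f ∘L K j‖), Finset.card_attach, nsmul_eq_mul] at h2
    have h3 : (s.card : ℝ) * (1 / (2 * (s.card + 1)) * ‖f‖) ≤ 1 / 2 * ‖f‖ := by
      rw [← mul_assoc]
      gcongr
      rw [mul_one_div, div_le_div_iff₀ (by positivity) (by norm_num)]
      linarith
    linarith [h f]
  let B : (t' → ℂ) →L[ℂ] F := ∑ y : t', (ContinuousLinearMap.proj y).smulRight (y : F)
  have hB : ∀ y : t', B (Pi.single y 1) = y := by
    intro y
    simp [B, sum_apply, Pi.single_apply, Finset.sum_ite_eq']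
  let T : E × (t' → ℂ) →L[ℂ] F := A.coprod B
  have hT : ∀ f : StrongDual ℂ F, ‖f‖ ≤ (2 * |C| + 2 * s.card * t'.card) * ‖f ∘L T‖ := by
    intro f
    have h1 : ‖f ∘L A‖ ≤ ‖f ∘L T‖ := by
      refine ContinuousLinearMap.opNorm_le_bound _ (norm_nonneg _) fun u => ?_
      have := (f ∘L T).le_opNorm (u, 0)
      simpa [T] using this
    have h2 : ∀ y ∈ t', ‖f y‖ ≤ ‖f ∘L T‖ := by
      intro y hy
      have h3 := (f ∘L T).le_opNorm (0, Pi.single ⟨y, hy⟩ 1)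
      have h4 : (f ∘L T) (0, Pi.single ⟨y, hy⟩ 1) = f y := by
        simp [T, hB]
      have h5 : ‖((0 : E), (Pi.single ⟨y, hy⟩ 1 : t' → ℂ))‖ = 1 := by
        rw [Prod.norm_def, Pi.norm_single]
        simp
      rwa [h4, h5, mul_one] at h3
    have h6 := Finset.sum_le_card_nsmul _ _ _ h2
    rw [nsmul_eq_mul] at h6
    calc ‖f‖ ≤ 2 * C * ‖f ∘L A‖ + 2 * s.card * ∑ y ∈ t', ‖f y‖ := hbound f
      _ ≤ 2 * |C| * ‖f ∘L T‖ + 2 * s.card * (t'.card * ‖f ∘L T‖) := by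
          gcongr
          exact le_abs_self C
      _ = _ := by ring
  have hsurj : Function.Surjective T := by
    refine surjective_of_dual_lower_bound T (c := (2 * |C| + 2 * s.card * t'.card + 1)⁻¹)
      (by positivity) fun f => ?_
    rw [inv_mul_le_iff₀ (by positivity)]
    linarith [hT f, norm_nonneg (f ∘L T)]
  refine Module.Finite.of_surjective (A.range.mkQ ∘ₗ B.toLinearMap) fun z => ?_
  obtain ⟨y, rfl⟩ := A.range.mkQ_surjective z
  obtain ⟨⟨u, v⟩, rfl⟩ := hsurj y
  refine ⟨v, ?_⟩
  simp only [LinearMap.comp_apply, Submodule.mkQ_apply]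
  rw [Submodule.Quotient.eq]
  refine ⟨-u, ?_⟩
  simp [T]

lemma isCompactOperator_of_hasFiniteRange (T : E →L[ℂ] F) (hT : T.toLinearMap.HasFiniteRange) :
    IsCompactOperator T := by
  have h1 : FiniteDimensional ℂ T.range := Module.Finite.iff_fg.2 hT
  have h2 : ProperSpace T.range := FiniteDimensional.proper ℂ _
  have h3 : IsCompactOperator T.rangeRestrict :=
    isCompactOperator_of_locallyCompactSpace_dom T.rangeRestrict
  exact h3.clm_comp T.range.subtypeL

/-- Fredholm operators are invertible modulo compact operators. -/
lemma ContinuousLinearMap.IsFredholm.exists_regularizer {A : E →L[ℂ] F} (hA : A.IsFredholm) :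
    ∃ L : F →L[ℂ] E, IsCompactOperator (L ∘L A - ContinuousLinearMap.id ℂ E) ∧
      IsCompactOperator (A ∘L L - ContinuousLinearMap.id ℂ F) := by
  obtain ⟨L, h1, h2⟩ := hA.exists_isQuasiInverse
  exact ⟨L, isCompactOperator_of_hasFiniteRange _ (LinearMap.FiniteRangeSetoid.equiv_iff_hasFiniteRange.1 h1),
    isCompactOperator_of_hasFiniteRange _ (LinearMap.FiniteRangeSetoid.equiv_iff_hasFiniteRange.1 h2)⟩

end Fredholm

/-! ### Limit operators in the abstract setting -/

section LimitOperators

variable {G E : Type*} [AddCommGroup G] [NormedAddCommGroup E] [NormedSpace ℂ E]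
  {P V : G → E →L[ℂ] E} {p : ℝ}

lemma IsShiftFamily.norm_le_one (hV : IsShiftFamily P V) (g : G) : ‖V g‖ ≤ 1 :=
  ContinuousLinearMap.opNorm_le_bound _ zero_le_one fun u => by rw [hV.norm_map, one_mul]

/-- The shifts on the dual space. -/
lemma IsShiftFamily.dual (hV : IsShiftFamily P V) :
    IsShiftFamily (E := StrongDual ℂ E) (fun a => ContinuousLinearMap.precomp ℂ (P a))
      (fun g => ContinuousLinearMap.precomp ℂ (V (-g))) where
  norm_map g f := by
    rw [ContinuousLinearMap.precomp_apply]
    refine le_antisymm ?_ ?_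
    · refine (ContinuousLinearMap.opNorm_comp_le _ _).trans ?_
      exact mul_le_of_le_one_right (norm_nonneg _) (hV.norm_le_one _)
    · refine ContinuousLinearMap.opNorm_le_bound _ (norm_nonneg _) fun u => ?_
      have := (f ∘L V (-g)).le_opNorm (V g u)
      rwa [ContinuousLinearMap.comp_apply, hV.neg_apply, hV.norm_map] at this
  neg_apply g f := by
    ext u
    simp [hV.neg_apply]
  map_proj g a f := by
    ext u
    simp [hV.proj_apply]

lemma norm_precomp_le {F : Type*} [NormedAddCommGroup F] [NormedSpace ℂ F] (T : E →L[ℂ] F) :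
    ‖(ContinuousLinearMap.precomp ℂ T : StrongDual ℂ F →L[ℂ] StrongDual ℂ E)‖ ≤ ‖T‖ :=
  ContinuousLinearMap.opNorm_le_bound _ (norm_nonneg _) fun f => by
    rw [ContinuousLinearMap.precomp_apply, mul_comm]
    exact ContinuousLinearMap.opNorm_comp_le _ _

lemma finProj_dual (S : Finset G) (f : StrongDual ℂ E) :
    finProj (E := StrongDual ℂ E) (fun a => ContinuousLinearMap.precomp ℂ (P a)) S f =
      f ∘L finProj P S := by
  ext u
  simp [finProj, sum_apply]

/-- Passing to the adjoint transposes the block matrix, so the diagonal `β` becomes the diagonal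
`-β`. -/
lemma IsWiener.dual {A : E →L[ℂ] E} (hA : IsWiener P A) :
    IsWiener (E := StrongDual ℂ E) (fun a => ContinuousLinearMap.precomp ℂ (P a))
      (ContinuousLinearMap.precomp ℂ A) := by
  refine lt_of_le_of_lt ?_ hA
  rw [← (Equiv.neg G).tsum_eq (fun β => ⨆ α : G, ‖P α ∘L A ∘L P (α - β)‖ₑ)]
  refine ENNReal.tsum_le_tsum fun β => iSup_le fun α => ?_
  refine le_trans ?_ (le_iSup _ (α - β))
  simp only [Equiv.neg_apply, sub_neg_eq_add, sub_add_cancel]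
  rw [← ofReal_norm, ← ofReal_norm]
  exact ENNReal.ofReal_le_ofReal (norm_precomp_le (P (α - β) ∘L A ∘L P α))

/-- A priori estimates pass to limit operators. -/
lemma LpDecomp.lower_bound_of_limit [CompleteSpace E] (hP : LpDecomp P p) (hp : 0 < p)
    (hV : IsShiftFamily P V) {A B Q : E →L[ℂ] E} {C : ℝ} (hC : 0 ≤ C)
    (hest : ∀ u, ‖u‖ ≤ C * ‖A u‖ + ‖Q u‖) {h : ℕ → G}
    (hQ : ∀ a u, Tendsto (fun m => ‖Q (V (h m) (P a u))‖) atTop (𝓝 0))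
    (hlim : ∀ S : Finset G, Tendsto
        (fun m => ‖(V (-h m) ∘L A ∘L V (h m) - B) ∘L finProj P S‖) atTop (𝓝 0)) (u : E) :
    ‖u‖ ≤ C * ‖B u‖ := by
  have key : ∀ S : Finset G, ‖finProj P S u‖ ≤ C * ‖B (finProj P S u)‖ := by
    intro S
    set y := finProj P S u with hy
    -- The estimate is applied to the shifted vector `V (h m) y`; as `m → ∞` the approximation error
    -- and the `Q`-terms disappear.
    have h1 : ∀ m, ‖y‖ ≤ C * (‖B y‖ + ‖(V (-h m) ∘L A ∘L V (h m) - B) ∘L finProj P S‖ * ‖u‖) +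
        ∑ a ∈ S, ‖Q (V (h m) (P a u))‖ := by
      intro m
      have h2 := hest (V (h m) y)
      rw [hV.norm_map] at h2
      refine h2.trans (add_le_add ?_ ?_)
      · gcongr
        have h3 := ((V (-h m) ∘L A ∘L V (h m) - B) ∘L finProj P S).le_opNorm u
        have h4 : ((V (-h m) ∘L A ∘L V (h m) - B) ∘L finProj P S) u =
            V (-h m) (A (V (h m) y)) - B y := by simp [hy]
        rw [h4] at h3
        have h5 := norm_sub_norm_le (V (-h m) (A (V (h m) y))) (B y)
        rw [hV.norm_map] at h5
        linarith
      · have h6 : Q (V (h m) y) = ∑ a ∈ S, Q (V (h m) (P a u)) := by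
          simp [hy, finProj, sum_apply]
        rw [h6]
        exact norm_sum_le _ _
    have h7 : Tendsto (fun m => C * (‖B y‖ +
        ‖(V (-h m) ∘L A ∘L V (h m) - B) ∘L finProj P S‖ * ‖u‖) +
        ∑ a ∈ S, ‖Q (V (h m) (P a u))‖) atTop (𝓝 (C * (‖B y‖ + 0 * ‖u‖) + ∑ a ∈ S, 0)) :=
      ((tendsto_const_nhds.add ((hlim S).mul_const _)).const_mul C).add
        (tendsto_finsetSum S fun a _ => hQ a u)
    simpa using ge_of_tendsto' h7 h1
  have h8 := hP.tendsto_finProj hp u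
  exact le_of_tendsto_of_tendsto' h8.norm
    (((B.continuous.tendsto u).comp h8).norm.const_mul C) key

lemma isUnit_of_lower_bounds [CompleteSpace E] (B : E →L[ℂ] E) {C C' : ℝ}
    (h : ∀ u, ‖u‖ ≤ C * ‖B u‖) (h' : ∀ f : StrongDual ℂ E, ‖f‖ ≤ C' * ‖f ∘L B‖) : IsUnit B := by
  have hinj : B.ker = ⊥ := by
    rw [LinearMap.ker_eq_bot']
    intro u hu
    have h1 := h u
    have h2 : B u = 0 := hu
    rw [h2, norm_zero, mul_zero] at h1
    simpa using h1
  have hsurj : B.range = ⊤ := by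
    rw [LinearMap.range_eq_top]
    refine surjective_of_dual_lower_bound B (c := (|C'| + 1)⁻¹) (by positivity) fun f => ?_
    rw [inv_mul_le_iff₀ (by positivity)]
    have h1 : C' * ‖f ∘L B‖ ≤ |C'| * ‖f ∘L B‖ := by gcongr; exact le_abs_self C'
    linarith [h' f, norm_nonneg (f ∘L B)]
  rw [← ContinuousLinearEquiv.coe_ofBijective B hinj hsurj]
  exact ⟨ContinuousLinearEquiv.toUnit _, rfl⟩

/-- Limit operators of Fredholm operators are invertible. -/
theorem isUnit_limit_of_isFredholm [CompleteSpace E] (hP : LpDecomp P p) (hp : 1 < p)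
    (hV : IsShiftFamily P V) {A B : E →L[ℂ] E} (hA : A.IsFredholm) {h : ℕ → G}
    (hh : Tendsto h atTop cofinite)
    (hr : ∀ S : Finset G, Tendsto
      (fun m => ‖(V (-h m) ∘L A ∘L V (h m) - B) ∘L finProj P S‖) atTop (𝓝 0))
    (hl : ∀ S : Finset G, Tendsto
      (fun m => ‖finProj P S ∘L (V (-h m) ∘L A ∘L V (h m) - B)‖) atTop (𝓝 0)) : IsUnit B := by
  have hp0 : 0 < p := by linarith
  have hpq := Real.HolderConjugate.conjExponent hp
  obtain ⟨L, hK, hK'⟩ := hA.exists_regularizer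
  set K := L ∘L A - ContinuousLinearMap.id ℂ E with hKdef
  set K' := A ∘L L - ContinuousLinearMap.id ℂ E with hKdef'
  have hha : ∀ a, Tendsto (fun m => a + h m) atTop cofinite := fun a =>
    (add_right_injective a).tendsto_cofinite.comp hh
  refine isUnit_of_lower_bounds B (C := ‖L‖) (C' := ‖L‖) (fun u => ?_) (fun f => ?_)
  · refine hP.lower_bound_of_limit hp0 hV (norm_nonneg L) (Q := K) (fun u => ?_) (fun a u => ?_) hr u
    · have h1 : u = L (A u) - K u := by simp [hKdef]
      calc ‖u‖ = ‖L (A u) - K u‖ := by rw [← h1]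
        _ ≤ ‖L‖ * ‖A u‖ + ‖K u‖ := (norm_sub_le _ _).trans (by gcongr; exact L.le_opNorm _)
    · refine hP.tendsto_compact_apply hp hK (hha a) (C := ‖P a u‖) (fun m => ?_) fun m => ?_
      · rw [← hV.map_proj, hP.idem]
      · rw [hV.norm_map]
  · have h2 := (hP.dual hpq).lower_bound_of_limit hpq.symm.pos hV.dual (norm_nonneg L)
      (A := ContinuousLinearMap.precomp ℂ A) (B := ContinuousLinearMap.precomp ℂ B)
      (Q := ContinuousLinearMap.precomp ℂ K') (h := h) (fun f => ?_) (fun a f => ?_) (fun S => ?_) f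
    · exact h2
    · simp only [ContinuousLinearMap.precomp_apply]
      have h1 : f = (f ∘L A) ∘L L - f ∘L K' := by ext u; simp [hKdef']
      calc ‖f‖ = ‖(f ∘L A) ∘L L - f ∘L K'‖ := by rw [← h1]
        _ ≤ ‖L‖ * ‖f ∘L A‖ + ‖f ∘L K'‖ := (norm_sub_le _ _).trans (by
            rw [mul_comm]; gcongr; exact ContinuousLinearMap.opNorm_comp_le _ _)
    · simp only [ContinuousLinearMap.precomp_apply]
      -- On the dual side compactness enters through the norm decay of the rows of `K'`, so
      -- compactness of its adjoint is not needed.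
      refine squeeze_zero (g := fun m => ‖f‖ * ‖P (a + h m) ∘L K'‖) (fun m => norm_nonneg _)
        (fun m => ?_) ?_
      · have h3 : ((f ∘L P a) ∘L V (-h m)) ∘L K' = (f ∘L V (-h m)) ∘L (P (a + h m) ∘L K') := by
          ext u
          simp [hV.proj_apply]
        rw [h3]
        refine (ContinuousLinearMap.opNorm_comp_le _ _).trans ?_
        gcongr
        exact (ContinuousLinearMap.opNorm_comp_le _ _).trans
          (mul_le_of_le_one_right (norm_nonneg _) (hV.norm_le_one _))
      · simpa using ((hP.tendsto_norm_comp_compact hp0 hK').comp (hha a)).const_mul ‖f‖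
    · refine squeeze_zero (fun m => norm_nonneg _) (fun m => ?_) (hl S)
      refine le_trans (le_of_eq ?_) (norm_precomp_le _)
      congr 1
      ext f u
      simp [finProj_dual]

/-- If all limit operators of a rich operator in the Wiener algebra are invertible then the
operator and its adjoint are bounded below at infinity. -/
theorem exists_lower_bounds_of_isUnit_limits [CompleteSpace E] [Countable G] [DecidableEq G]
    (hP : LpDecomp P p) (hp : 1 < p) (hG : HasFolnerSets G) (hV : IsShiftFamily P V)
    {A : E →L[ℂ] E} (hA : IsWiener P A)
    (hlim : ∀ h : ℕ → G, Tendsto h atTop cofinite → ∃ φ : ℕ → ℕ, StrictMono φ ∧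
      ∃ B : E →L[ℂ] E, IsUnit B ∧
        (∀ S : Finset G, Tendsto
          (fun m => ‖(V (-h (φ m)) ∘L A ∘L V (h (φ m)) - B) ∘L finProj P S‖) atTop (𝓝 0)) ∧
        (∀ S : Finset G, Tendsto
          (fun m => ‖finProj P S ∘L (V (-h (φ m)) ∘L A ∘L V (h (φ m)) - B)‖) atTop (𝓝 0))) :
    ∃ S : Finset G, ∃ c > 0, (∀ u, finProj P S u = 0 → c * ‖u‖ ≤ ‖A u‖) ∧
      ∀ f : StrongDual ℂ E, f ∘L finProj P S = 0 → c * ‖f‖ ≤ ‖f ∘L A‖ := by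
  have hp0 : 0 < p := by linarith
  have hpq := Real.HolderConjugate.conjExponent hp
  obtain ⟨S₁, c₁, hc₁, h₁⟩ := hP.exists_lower_bound_at_infinity hp.le hG hV hA fun h hh => by
    obtain ⟨φ, hφ, B, hB, hr, -⟩ := hlim h hh
    refine ⟨φ, hφ, B, hr, ?_⟩
    obtain ⟨L, hL⟩ := hB.exists_left_inv
    refine ⟨(‖L‖ + 1)⁻¹, by positivity, fun u => ?_⟩
    rw [inv_mul_le_iff₀ (by positivity)]
    have h1 : L (B u) = u := congrArg (fun T : E →L[ℂ] E => T u) hL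
    calc ‖u‖ = ‖L (B u)‖ := by rw [h1]
      _ ≤ ‖L‖ * ‖B u‖ := L.le_opNorm _
      _ ≤ _ := by gcongr; linarith
  -- The same theorem for the adjoint: convergence with the projections on the left becomes
  -- convergence with the dual projections on the right, and a right inverse yields the lower bound.
  obtain ⟨S₂, c₂, hc₂, h₂⟩ := (hP.dual hpq).exists_lower_bound_at_infinity hpq.symm.lt.le hG
    hV.dual hA.dual fun h hh => by
    obtain ⟨φ, hφ, B, hB, -, hl⟩ := hlim h hh
    refine ⟨φ, hφ, ContinuousLinearMap.precomp ℂ B, fun S => ?_, ?_⟩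
    · refine squeeze_zero (fun m => norm_nonneg _) (fun m => ?_) (hl S)
      refine le_trans (le_of_eq ?_) (norm_precomp_le _)
      congr 1
      ext f u
      simp [finProj_dual]
    · obtain ⟨R, hR⟩ := hB.exists_right_inv
      refine ⟨(‖R‖ + 1)⁻¹, by positivity, fun f => ?_⟩
      rw [inv_mul_le_iff₀ (by positivity), ContinuousLinearMap.precomp_apply]
      have h1 : f = (f ∘L B) ∘L R := by
        ext u
        exact congrArg (fun T : E →L[ℂ] E => f (T u)) hR.symm
      calc ‖f‖ = ‖(f ∘L B) ∘L R‖ := by rw [← h1]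
        _ ≤ ‖f ∘L B‖ * ‖R‖ := ContinuousLinearMap.opNorm_comp_le _ _
        _ ≤ _ := by rw [mul_comm]; gcongr; linarith
  have hz : ∀ S T : Finset G, S ⊆ T → finProj P S = finProj P S ∘L finProj P T ∧
      finProj P S = finProj P T ∘L finProj P S := by
    intro S T hST
    constructor <;> ext u <;> refine hP.ext hp0 fun a => ?_ <;>
      simp only [ContinuousLinearMap.comp_apply, hP.apply_finProj] <;>
      by_cases ha : a ∈ S <;> simp [ha, fun h => hST h]
  refine ⟨S₁ ∪ S₂, min c₁ c₂, lt_min hc₁ hc₂, fun u hu => ?_, fun f hf => ?_⟩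
  · refine le_trans (by gcongr; exact min_le_left _ _) (h₁ u ?_)
    rw [(hz S₁ _ Finset.subset_union_left).1, ContinuousLinearMap.comp_apply, hu, map_zero]
  · refine le_trans (by gcongr; exact min_le_right _ _) (h₂ f ?_)
    rw [finProj_dual, (hz S₂ _ Finset.subset_union_right).2, ← ContinuousLinearMap.comp_assoc, hf,
      ContinuousLinearMap.zero_comp]

end LimitOperators

/-! ### Multiplication by characteristic functions and shifts -/

section Chi

variable {α : Type*} [MeasurableSpace α] {μ : Measure α} {p : ℝ≥0∞} [Fact (1 ≤ p)]

lemma coeFn_chi (S : Set α) (hS : MeasurableSet S) (u : Lp ℂ p μ) :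
    chi μ p S hS u =ᵐ[μ] S.indicator (u : α → ℂ) := coeFn_chiFun μ p S hS u

lemma chi_apply_chi (S T : Set α) (hS : MeasurableSet S) (hT : MeasurableSet T) (u : Lp ℂ p μ) :
    chi μ p S hS (chi μ p T hT u) = chi μ p (S ∩ T) (hS.inter hT) u := by
  apply Lp.ext
  filter_upwards [coeFn_chi S hS (chi μ p T hT u), coeFn_chi T hT u,
    coeFn_chi (S ∩ T) (hS.inter hT) u] with x h1 h2 h3
  rw [h1, h3]
  by_cases hx : x ∈ S
  · rw [indicator_of_mem hx, h2]
    by_cases hx' : x ∈ T <;> simp [hx, hx']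
  · simp [hx]

lemma chi_congr {S T : Set α} (hS : MeasurableSet S) (hT : MeasurableSet T) (h : S = T) :
    chi μ p S hS = chi μ p T hT := by
  subst h; rfl

lemma chi_univ (u : Lp ℂ p μ) : chi μ p univ MeasurableSet.univ u = u := by
  apply Lp.ext
  filter_upwards [coeFn_chi univ MeasurableSet.univ u] with x h1
  rw [h1, indicator_univ]

lemma chi_empty (u : Lp ℂ p μ) : chi μ p ∅ MeasurableSet.empty u = 0 := by
  apply Lp.ext
  filter_upwards [coeFn_chi ∅ MeasurableSet.empty u, Lp.coeFn_zero ℂ p μ] with x h1 h2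
  rw [h1, h2, indicator_empty]
  rfl

lemma chi_apply_chi_of_subset {S T : Set α} (hS : MeasurableSet S) (hT : MeasurableSet T)
    (h : S ⊆ T) (u : Lp ℂ p μ) : chi μ p S hS (chi μ p T hT u) = chi μ p S hS u := by
  rw [chi_apply_chi, chi_congr _ hS (inter_eq_left.2 h)]

lemma chi_apply_chi_of_superset {S T : Set α} (hS : MeasurableSet S) (hT : MeasurableSet T)
    (h : S ⊆ T) (u : Lp ℂ p μ) : chi μ p T hT (chi μ p S hS u) = chi μ p S hS u := by
  rw [chi_apply_chi, chi_congr _ hS (inter_eq_right.2 h)]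

lemma chi_apply_chi_of_disjoint {S T : Set α} (hS : MeasurableSet S) (hT : MeasurableSet T)
    (h : Disjoint S T) (u : Lp ℂ p μ) : chi μ p S hS (chi μ p T hT u) = 0 := by
  rw [chi_apply_chi, chi_congr _ MeasurableSet.empty h.inter_eq, chi_empty]

lemma norm_chi_le_one (S : Set α) (hS : MeasurableSet S) : ‖chi μ p S hS‖ ≤ 1 :=
  LinearMap.mkContinuous_norm_le _ zero_le_one _

lemma chi_union_eq {S T : Set α} (hS : MeasurableSet S) (hT : MeasurableSet T) :
    chi μ p (S ∪ T) (hS.union hT) = chi μ p S hS + chi μ p (T \ S) (hT.diff hS) := by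
  ext1 u
  rw [_root_.add_apply]
  apply Lp.ext
  filter_upwards [coeFn_chi _ (hS.union hT) u, coeFn_chi S hS u, coeFn_chi _ (hT.diff hS) u,
    Lp.coeFn_add (chi μ p S hS u) (chi μ p (T \ S) (hT.diff hS) u)] with x h1 h2 h3 h4
  rw [h4, Pi.add_apply, h1, h2, h3]
  by_cases hx : x ∈ S <;> by_cases hx' : x ∈ T <;> simp [hx, hx']

lemma norm_chi_union_le {S T : Set α} (hS : MeasurableSet S) (hT : MeasurableSet T)
    (u : Lp ℂ p μ) :
    ‖chi μ p (S ∪ T) (hS.union hT) u‖ ≤ ‖chi μ p S hS u‖ + ‖chi μ p T hT u‖ := by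
  rw [chi_union_eq hS hT, _root_.add_apply, ← chi_apply_chi_of_subset (hT.diff hS) hT sdiff_subset]
  refine (norm_add_le _ _).trans ?_
  gcongr
  exact ((chi μ p (T \ S) (hT.diff hS)).le_of_opNorm_le (norm_chi_le_one _ _) _).trans_eq
    (one_mul _)

lemma norm_comp_chi_union_le {S T : Set α} (hS : MeasurableSet S) (hT : MeasurableSet T)
    (f : StrongDual ℂ (Lp ℂ p μ)) :
    ‖f ∘L chi μ p (S ∪ T) (hS.union hT)‖ ≤ ‖f ∘L chi μ p S hS‖ + ‖f ∘L chi μ p T hT‖ := by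
  have h1 : f ∘L chi μ p (T \ S) (hT.diff hS) =
      (f ∘L chi μ p T hT) ∘L chi μ p (T \ S) (hT.diff hS) := by
    ext u
    simp [chi_apply_chi_of_superset (hT.diff hS) hT sdiff_subset]
  rw [chi_union_eq hS hT, ContinuousLinearMap.comp_add, h1]
  refine (norm_add_le _ _).trans ?_
  gcongr
  exact (ContinuousLinearMap.opNorm_comp_le _ _).trans
    (mul_le_of_le_one_right (norm_nonneg _) (norm_chi_le_one _ _))

/-- The sets may overlap: in the induction a new set is replaced by its part outside the earlier
ones, which does not increase the norms. -/
lemma exists_iUnion_chi_bound {ι : Type*} (s : Finset ι) (S : ι → Set α)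
    (hS : ∀ i, MeasurableSet (S i)) (hcover : ∀ x, ∃ i ∈ s, x ∈ S i) :
    (∀ u : Lp ℂ p μ, ‖u‖ ≤ ∑ i ∈ s, ‖chi μ p (S i) (hS i) u‖) ∧
      ∀ f : StrongDual ℂ (Lp ℂ p μ), ‖f‖ ≤ ∑ i ∈ s, ‖f ∘L chi μ p (S i) (hS i)‖ := by
  classical
  have key : ∀ t : Finset ι, ∃ hU : MeasurableSet (⋃ i ∈ t, S i),
      (∀ u : Lp ℂ p μ, ‖chi μ p _ hU u‖ ≤ ∑ i ∈ t, ‖chi μ p (S i) (hS i) u‖) ∧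
      ∀ f : StrongDual ℂ (Lp ℂ p μ), ‖f ∘L chi μ p _ hU‖ ≤
        ∑ i ∈ t, ‖f ∘L chi μ p (S i) (hS i)‖ := by
    intro t
    induction t using Finset.induction_on with
    | empty =>
      refine ⟨by simp, fun u => ?_, fun f => ?_⟩
      · rw [chi_congr _ MeasurableSet.empty (by simp), chi_empty]; simp
      · have : f ∘L chi μ p ∅ MeasurableSet.empty = 0 := by ext u; simp [chi_empty]
        rw [chi_congr _ MeasurableSet.empty (by simp), this]; simp
    | insert i t hi ih =>
      obtain ⟨hU, h1, h2⟩ := ih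
      have hset : (⋃ j ∈ insert i t, S j) = S i ∪ ⋃ j ∈ t, S j := by
        rw [Finset.set_biUnion_insert]
      refine ⟨by rw [hset]; exact (hS i).union hU, fun u => ?_, fun f => ?_⟩
      · rw [chi_congr _ ((hS i).union hU) hset, Finset.sum_insert hi]
        exact (norm_chi_union_le _ _ _).trans (by gcongr; exact h1 u)
      · rw [chi_congr _ ((hS i).union hU) hset, Finset.sum_insert hi]
        exact (norm_comp_chi_union_le _ _ _).trans (by gcongr; exact h2 f)
  obtain ⟨hU, h1, h2⟩ := key s
  have huniv : (⋃ i ∈ s, S i) = univ := by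
    refine eq_univ_of_forall fun x => ?_
    obtain ⟨i, hi, hx⟩ := hcover x
    exact mem_iUnion₂.2 ⟨i, hi, hx⟩
  refine ⟨fun u => ?_, fun f => ?_⟩
  · have := h1 u
    rwa [chi_congr _ MeasurableSet.univ huniv, chi_univ] at this
  · have := h2 f
    have h3 : f ∘L chi μ p univ MeasurableSet.univ = f := by ext u; simp [chi_univ]
    rwa [chi_congr _ MeasurableSet.univ huniv, h3] at this

lemma enorm_Lp_rpow (hp : p ≠ ∞) (u : Lp ℂ p μ) :
    ‖u‖ₑ ^ p.toReal = ∫⁻ x, ‖u x‖ₑ ^ p.toReal ∂μ := by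
  have hp1 : 1 ≤ p := Fact.out
  have hp0 : p ≠ 0 := (zero_lt_one.trans_le hp1).ne'
  rw [Lp.enorm_def, eLpNorm_eq_lintegral_rpow_enorm_toReal hp0 hp, ← ENNReal.rpow_mul,
    one_div_mul_cancel (ENNReal.toReal_pos hp0 hp).ne', ENNReal.rpow_one]

/-- A countable measurable partition decomposes the Lebesgue space. -/
lemma lpDecomp_chi {ι : Type*} [Countable ι] (hp : p ≠ ∞) (S : ι → Set α)
    (hS : ∀ i, MeasurableSet (S i)) (hpart : ∀ x, ∃! i, x ∈ S i) :
    LpDecomp (fun i => chi μ p (S i) (hS i)) p.toReal := by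
  have hp1 : 1 ≤ p := Fact.out
  have hp0 : p ≠ 0 := (zero_lt_one.trans_le hp1).ne'
  have hdisj : Pairwise (Function.onFun Disjoint S) := fun i j hij =>
    Set.disjoint_left.2 fun x hi hj => hij ((hpart x).unique hi hj)
  refine ⟨fun i u => chi_apply_chi_of_subset _ _ subset_rfl u,
    fun i j hij u => chi_apply_chi_of_disjoint _ _ (hdisj hij) u, fun u => ?_⟩
  have huniv : (⋃ i, S i) = univ := eq_univ_of_forall fun x => mem_iUnion.2 (hpart x).exists
  rw [enorm_Lp_rpow hp u, ← setLIntegral_univ, ← huniv, lintegral_iUnion hS hdisj]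
  refine tsum_congr fun i => ?_
  rw [enorm_Lp_rpow hp, ← lintegral_indicator (hS i)]
  refine lintegral_congr_ae ?_
  filter_upwards [coeFn_chi (S i) (hS i) u] with x hx
  rw [hx]
  by_cases h : x ∈ S i
  · simp [h]
  · simp [h, ENNReal.toReal_pos hp0 hp]

end Chi

/-! ### Cells, shifts and limit operators on the metric graph -/

section Shift

variable {n : ℕ} {V : Type*} {Γ : PeriodicMetricGraph n V} {w : PeriodicWeight Γ}
  {p : ℝ≥0∞} [Fact (1 ≤ p)]

lemma coeFn_shift (g : Fin n → ℤ) (u : LpW Γ w p) :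
    shift Γ w p g u =ᵐ[Γ.weightedMeasure w p] fun x => u (-g +ᵥ x) :=
  Lp.coeFn_compMeasurePreserving u (Γ.measurePreserving_weighted w p (-g))

lemma shift_neg_apply_shift (g : Fin n → ℤ) (u : LpW Γ w p) :
    shift Γ w p (-g) (shift Γ w p g u) = u := by
  apply Lp.ext
  have h1 := (Γ.measurePreserving_weighted w p (- -g)).quasiMeasurePreserving.ae_eq_comp
    (coeFn_shift g u)
  filter_upwards [coeFn_shift (-g) (shift Γ w p g u), h1] with x h2 h3
  rw [h2]
  refine h3.trans ?_
  simp

lemma shift_chiW {D : Set Γ.Space} (hD : IsFundDomain Γ D) (g a : Fin n → ℤ) (u : LpW Γ w p) :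
    shift Γ w p g (chiW Γ w p (cell D a) (hD.measurableSet_cell a) u) =
      chiW Γ w p (cell D (a + g)) (hD.measurableSet_cell (a + g)) (shift Γ w p g u) := by
  apply Lp.ext
  have h1 := (Γ.measurePreserving_weighted w p (-g)).quasiMeasurePreserving.ae_eq_comp
    (coeFn_chi (cell D a) (hD.measurableSet_cell a) u)
  filter_upwards [coeFn_shift g (chiW Γ w p (cell D a) (hD.measurableSet_cell a) u), h1,
    coeFn_shift g u, coeFn_chi (cell D (a + g)) (hD.measurableSet_cell (a + g))
      (shift Γ w p g u)] with x h2 h3 h4 h5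
  refine h2.trans (h3.trans (Eq.trans ?_ h5.symm))
  have hmem : -g +ᵥ x ∈ cell D a ↔ x ∈ cell D (a + g) := by
    simp [cell, vadd_vadd, neg_add_rev, add_comm]
  by_cases hx : x ∈ cell D (a + g)
  · rw [Function.comp_apply, indicator_of_mem hx, indicator_of_mem (hmem.2 hx), h4]
  · rw [Function.comp_apply, indicator_of_notMem hx, indicator_of_notMem (fun h => hx (hmem.1 h))]

lemma IsFundDomain.lpDecomp {D : Set Γ.Space} (hD : IsFundDomain Γ D) (hp : p ≠ ∞) :
    LpDecomp (fun g => chiW Γ w p (cell D g) (hD.measurableSet_cell g)) p.toReal :=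
  lpDecomp_chi hp _ _ fun x => hD.existsUnique x

lemma IsFundDomain.isShiftFamily {D : Set Γ.Space} (hD : IsFundDomain Γ D) :
    IsShiftFamily (fun g => chiW Γ w p (cell D g) (hD.measurableSet_cell g)) (shift Γ w p) where
  norm_map _ u := LinearIsometry.norm_map _ u
  neg_apply := shift_neg_apply_shift
  map_proj := shift_chiW hD

/-- The union of finitely many closed cells. -/
def closedCells (D : Set Γ.Space) (S : Finset (Fin n → ℤ)) : Set Γ.Space :=
  ⋃ a ∈ S, (fun x : Γ.Space => -a +ᵥ x) ⁻¹' closure D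

lemma isClosed_closedCells (D : Set Γ.Space) (S : Finset (Fin n → ℤ)) :
    IsClosed (closedCells D S) :=
  S.finite_toSet.isClosed_biUnion fun a _ => isClosed_closure.preimage (Γ.continuous_vadd (-a))

lemma IsFundDomain.isCompact_closedCells {D : Set Γ.Space} (hD : IsFundDomain Γ D)
    (S : Finset (Fin n → ℤ)) : IsCompact (closedCells D S) := by
  refine S.finite_toSet.isCompact_biUnion fun a _ => ?_
  have : (fun x : Γ.Space => -a +ᵥ x) ⁻¹' closure D = (fun x => a +ᵥ x) '' closure D := by
    ext x
    constructor
    · intro hx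
      exact ⟨-a +ᵥ x, hx, vadd_neg_vadd a x⟩
    · rintro ⟨y, hy, rfl⟩
      simpa using hy
  rw [this]
  exact hD.isCompact_closure.image (Γ.continuous_vadd a)

lemma cell_subset_closedCells (D : Set Γ.Space) {S : Finset (Fin n → ℤ)} {a : Fin n → ℤ}
    (ha : a ∈ S) : cell D a ⊆ closedCells D S := fun _ hx =>
  mem_iUnion₂.2 ⟨a, ha, subset_closure hx⟩

lemma chiW_closedCells_comp_finProj {D : Set Γ.Space} (hD : IsFundDomain Γ D)
    (S : Finset (Fin n → ℤ)) :
    chiW Γ w p (closedCells D S) (isClosed_closedCells D S).measurableSet ∘L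
      finProj (fun g => chiW Γ w p (cell D g) (hD.measurableSet_cell g)) S =
      finProj (fun g => chiW Γ w p (cell D g) (hD.measurableSet_cell g)) S := by
  ext1 u
  simp only [finProj, ContinuousLinearMap.comp_apply, sum_apply, map_sum]
  exact Finset.sum_congr rfl fun a ha =>
    chi_apply_chi_of_superset _ _ (cell_subset_closedCells D ha) u

lemma finProj_comp_chiW_closedCells {D : Set Γ.Space} (hD : IsFundDomain Γ D)
    (S : Finset (Fin n → ℤ)) :
    finProj (fun g => chiW Γ w p (cell D g) (hD.measurableSet_cell g)) S ∘L
      chiW Γ w p (closedCells D S) (isClosed_closedCells D S).measurableSet =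
      finProj (fun g => chiW Γ w p (cell D g) (hD.measurableSet_cell g)) S := by
  ext1 u
  simp only [finProj, ContinuousLinearMap.comp_apply, sum_apply]
  exact Finset.sum_congr rfl fun a ha =>
    chi_apply_chi_of_subset _ _ (cell_subset_closedCells D ha) u

/-- Limit operators are tested on compact sets, while cells are only relatively compact. The closed
cells form a compact set whose characteristic function is absorbed by the finite projection. -/
lemma IsLimitOperator.tendsto_finProj {D : Set Γ.Space} (hD : IsFundDomain Γ D)
    {A B : LpW Γ w p →L[ℂ] LpW Γ w p} {h : ℕ → Fin n → ℤ} (hB : IsLimitOperator A h B)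
    (S : Finset (Fin n → ℤ)) :
    Tendsto (fun m => ‖(shift Γ w p (-h m) ∘L A ∘L shift Γ w p (h m) - B) ∘L
      finProj (fun g => chiW Γ w p (cell D g) (hD.measurableSet_cell g)) S‖) atTop (𝓝 0) ∧
    Tendsto (fun m => ‖finProj (fun g => chiW Γ w p (cell D g) (hD.measurableSet_cell g)) S ∘L
      (shift Γ w p (-h m) ∘L A ∘L shift Γ w p (h m) - B)‖) atTop (𝓝 0) := by
  obtain ⟨h1, h2⟩ := hB (closedCells D S) (isClosed_closedCells D S).measurableSet
    (hD.isCompact_closedCells S)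
  set Q := finProj (fun g => chiW Γ w p (cell D g) (hD.measurableSet_cell g)) S with hQ
  set X := chiW Γ w p (closedCells D S) (isClosed_closedCells D S).measurableSet with hX
  have hr : X ∘L Q = Q := chiW_closedCells_comp_finProj hD S
  have hl : Q ∘L X = Q := finProj_comp_chiW_closedCells hD S
  have h3 := h1.mul_const ‖Q‖
  have h4 := h2.const_mul ‖Q‖
  rw [zero_mul] at h3
  rw [mul_zero] at h4
  refine ⟨squeeze_zero (fun m => norm_nonneg _) (fun m => ?_) h3,
    squeeze_zero (fun m => norm_nonneg _) (fun m => ?_) h4⟩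
  · set Y := shift Γ w p (-h m) ∘L A ∘L shift Γ w p (h m) - B
    calc ‖Y ∘L Q‖ = ‖(Y ∘L X) ∘L Q‖ := by rw [ContinuousLinearMap.comp_assoc, hr]
      _ ≤ _ := ContinuousLinearMap.opNorm_comp_le _ _
  · set Y := shift Γ w p (-h m) ∘L A ∘L shift Γ w p (h m) - B
    calc ‖Q ∘L Y‖ = ‖Q ∘L (X ∘L Y)‖ := by rw [← ContinuousLinearMap.comp_assoc, hl]
      _ ≤ _ := ContinuousLinearMap.opNorm_comp_le _ _

end Shift

/-! ### Topology of metric graphs -/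

namespace MetricGraph

variable {V : Type*} (G : MetricGraph V)

lemma preProj_eq_inl {q : G.PreSpace} {v : V} (h : G.preProj q = Sum.inl v) :
    (q.1.1.1 = v ∧ (q.2 : ℝ) = 0) ∨ (q.1.1.2 = v ∧ (q.2 : ℝ) = G.len q.1) := by
  unfold preProj at h
  split_ifs at h with h1 h2
  · exact Or.inl ⟨Sum.inl_injective h, h1⟩
  · exact Or.inr ⟨Sum.inl_injective h, h2⟩

open Classical in
/-- The hat function of a vertex. -/
def hat (v : V) (q : G.PreSpace) : ℝ :=
  (if q.1.1.1 = v then 1 - q.2 / G.len q.1 else 0) + if q.1.1.2 = v then q.2 / G.len q.1 else 0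

open Classical in
/-- A function which is supported in an edge, with an additional factor `t ^ k`. -/
def bump (k : ℕ) (e : G.edges) (q : G.PreSpace) : ℝ :=
  if q.1 = e then (q.2 : ℝ) ^ k * (q.2 * (G.len q.1 - q.2)) else 0

lemma fst_ne_snd (e : G.edges) : e.1.1 ≠ e.1.2 := fun h => by
  have := G.no_loop e.1.1
  apply this
  have h2 : e.1 = (e.1.1, e.1.1) := Prod.ext rfl h.symm
  rw [← h2]
  exact e.2

open Classical in
lemma hat_of_preProj (v : V) {q : G.PreSpace} {u : V} (h : G.preProj q = Sum.inl u) :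
    G.hat v q = if u = v then 1 else 0 := by
  have hl := (G.len_pos q.1).ne'
  rcases G.preProj_eq_inl h with ⟨rfl, h2⟩ | ⟨rfl, h2⟩
  · simp [hat, h2]
  · simp [hat, h2, hl]

lemma bump_of_preProj (k : ℕ) (e : G.edges) {q : G.PreSpace} {u : V}
    (h : G.preProj q = Sum.inl u) : G.bump k e q = 0 := by
  rcases G.preProj_eq_inl h with ⟨-, h2⟩ | ⟨-, h2⟩ <;> simp [bump, h2]

lemma continuous_hat (v : V) : Continuous (G.hat v) := by
  refine continuous_sigma fun e => ?_
  simp only [hat]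
  split_ifs <;> fun_prop

lemma continuous_bump (k : ℕ) (e : G.edges) : Continuous (G.bump k e) := by
  refine continuous_sigma fun e' => ?_
  simp only [bump]
  split_ifs <;> fun_prop

/-- As there are no loops, at most one summand of the hat function is present on an edge, and it
equals one only at the end belonging to `v`. -/
lemma eq_one_of_hat {v : V} {q : G.PreSpace} (h : G.hat v q = 1) : G.preProj q = Sum.inl v := by
  have hl := (G.len_pos q.1).ne'
  have hne := G.fst_ne_snd q.1
  unfold hat at h
  unfold preProj
  split_ifs at h with h1 h2 h3
  · exact (hne (h1.trans h2.symm)).elim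
  · have h0 : (q.2 : ℝ) = 0 := by
      have : (q.2 : ℝ) / G.len q.1 = 0 := by linarith
      simpa [hl] using this
    rw [if_pos h0, h1]
  · have h0 : (q.2 : ℝ) = G.len q.1 := by
      rw [zero_add, div_eq_one_iff_eq hl] at h
      exact h
    rw [if_neg (by rw [h0]; exact hl), if_pos h0, h3]
  · norm_num at h

lemma preProj_of_bump_ne_zero {k : ℕ} {e : G.edges} {q : G.PreSpace} (h : G.bump k e q ≠ 0) :
    q.1 = e := by
  unfold bump at h
  by_contra h1
  exact h (if_neg h1)

lemma bump_pos {q : G.PreSpace} (h : ∀ v, G.preProj q ≠ Sum.inl v) : 0 < G.bump 0 q.1 q := by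
  have h0 : (q.2 : ℝ) ≠ 0 := fun h0 => h q.1.1.1 (by simp [preProj, h0])
  have h1 : (q.2 : ℝ) ≠ G.len q.1 := fun h1 => h q.1.1.2 (by
    simp [preProj, h1, (G.len_pos q.1).ne'])
  have h2 := q.2.2
  have h3 : 0 < (q.2 : ℝ) := lt_of_le_of_ne h2.1 h0.symm
  have h4 : (q.2 : ℝ) < G.len q.1 := lt_of_le_of_ne h2.2 h1
  simp only [bump, if_true, pow_zero, one_mul]
  exact mul_pos h3 (by linarith)

/-- Descent of functions which depend at the vertices only on the vertex. -/
def descend (f : G.PreSpace → ℝ) (hf : ∀ q q' v, G.preProj q = Sum.inl v →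
    G.preProj q' = Sum.inl v → f q = f q') : G.Space → ℝ :=
  Quotient.lift f fun q q' h => by
    rcases h with rfl | ⟨v, h1, h2⟩
    · rfl
    · exact hf q q' v h1 h2

/-- The hat function of a vertex on the metric graph. -/
def hatS (v : V) : G.Space → ℝ := G.descend (G.hat v) fun q q' u h h' => by
  classical
  rw [G.hat_of_preProj v h, G.hat_of_preProj v h']

/-- The function `bump` on the metric graph. -/
def bumpS (k : ℕ) (e : G.edges) : G.Space → ℝ := G.descend (G.bump k e) fun q q' u h h' => by
  rw [G.bump_of_preProj k e h, G.bump_of_preProj k e h']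

lemma continuous_hatS (v : V) : Continuous (G.hatS v) := (G.continuous_hat v).quotient_lift _

lemma continuous_bumpS (k : ℕ) (e : G.edges) : Continuous (G.bumpS k e) :=
  (G.continuous_bump k e).quotient_lift _

lemma toSpace_surjective : Function.Surjective G.toSpace := Quotient.mk_surjective

lemma toSpace_eq_of_preProj {q q' : G.PreSpace} {v : V} (h : G.preProj q = Sum.inl v)
    (h' : G.preProj q' = Sum.inl v) : G.toSpace q = G.toSpace q' :=
  Quotient.sound (Or.inr ⟨v, h, h'⟩)

/-- Continuous functions separate points: the hat functions recognize vertices, `bump 0` recognizes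
the edge of an interior point, and the quotient of `bump 1` by `bump 0` is its coordinate. Together
with local compactness this makes the one-point compactification Hausdorff. -/
instance : T2Space G.Space := by
  let f : G.Space → (V → ℝ) × (G.edges → ℝ) × (G.edges → ℝ) :=
    fun x => (fun v => G.hatS v x, fun e => G.bumpS 0 e x, fun e => G.bumpS 1 e x)
  have hf : Continuous f := by
    refine (continuous_pi fun v => G.continuous_hatS v).prodMk
      ((continuous_pi fun e => G.continuous_bumpS 0 e).prodMk
        (continuous_pi fun e => G.continuous_bumpS 1 e))
  refine T2Space.of_injective_continuous (f := f) ?_ hf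
  intro x y hxy
  obtain ⟨q, rfl⟩ := G.toSpace_surjective x
  obtain ⟨q', rfl⟩ := G.toSpace_surjective y
  have h1 : ∀ v, G.hat v q = G.hat v q' := fun v => congrFun (congrArg Prod.fst hxy) v
  have h2 : ∀ e, G.bump 0 e q = G.bump 0 e q' := fun e =>
    congrFun (congrArg (fun z => z.2.1) hxy) e
  have h3 : ∀ e, G.bump 1 e q = G.bump 1 e q' := fun e =>
    congrFun (congrArg (fun z => z.2.2) hxy) e
  by_cases hq : ∃ v, G.preProj q = Sum.inl v
  · obtain ⟨v, hv⟩ := hq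
    refine G.toSpace_eq_of_preProj hv (G.eq_one_of_hat ?_)
    rw [← h1, G.hat_of_preProj v hv, if_pos rfl]
  · push Not at hq
    have hpos := G.bump_pos hq
    have he : q'.1 = q.1 := G.preProj_of_bump_ne_zero (k := 0) (by rw [← h2]; exact hpos.ne')
    obtain ⟨e, t⟩ := q
    obtain ⟨e', t'⟩ := q'
    obtain rfl : e' = e := he
    have h4 := h2 e'
    have h5 := h3 e'
    simp only [bump, if_true, pow_zero, one_mul, pow_one] at h4 h5 hpos
    rw [← h4] at h5
    have h6 : t = t' := Subtype.ext (mul_right_cancel₀ hpos.ne' h5)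
    rw [h6]

lemma isCompact_edge (e : G.edges) : IsCompact (range fun t => G.toSpace ⟨e, t⟩) :=
  isCompact_range (G.continuous_toSpace.comp continuous_sigmaMk)

/-- The set where the hat function of a vertex is positive lies in the finitely many compact edges
at that vertex; for interior points the bump function singles out one edge. -/
instance : WeaklyLocallyCompactSpace G.Space := by
  refine ⟨fun x => ?_⟩
  obtain ⟨q, rfl⟩ := G.toSpace_surjective x
  by_cases hq : ∃ v, G.preProj q = Sum.inl v
  · obtain ⟨v, hv⟩ := hq
    have hfin : {e : G.edges | e.1.1 = v ∨ e.1.2 = v}.Finite := by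
      refine Finite.of_finite_image ((G.valency_finite v).subset ?_) Subtype.val_injective.injOn
      rintro _ ⟨e, he, rfl⟩
      exact ⟨e.2, he⟩
    refine ⟨⋃ e ∈ {e : G.edges | e.1.1 = v ∨ e.1.2 = v}, range fun t => G.toSpace ⟨e, t⟩,
      hfin.isCompact_biUnion fun e _ => G.isCompact_edge e, ?_⟩
    have hopen : IsOpen {x | 0 < G.hatS v x} := isOpen_lt continuous_const (G.continuous_hatS v)
    refine mem_of_superset (hopen.mem_nhds ?_) ?_
    · have : G.hat v q = 1 := by rw [G.hat_of_preProj v hv, if_pos rfl]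
      change 0 < G.hat v q
      rw [this]; exact one_pos
    · intro y hy
      obtain ⟨q', rfl⟩ := G.toSpace_surjective y
      have hy' : 0 < G.hat v q' := hy
      refine mem_iUnion₂.2 ⟨q'.1, ?_, ⟨q'.2, rfl⟩⟩
      by_contra hcon
      simp only [mem_ofPred_eq, not_or] at hcon
      simp [hat, hcon.1, hcon.2] at hy'
  · push Not at hq
    refine ⟨range fun t => G.toSpace ⟨q.1, t⟩, G.isCompact_edge q.1, ?_⟩
    have hopen : IsOpen {x | 0 < G.bumpS 0 q.1 x} :=
      isOpen_lt continuous_const (G.continuous_bumpS 0 q.1)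
    refine mem_of_superset (hopen.mem_nhds (G.bump_pos hq)) ?_
    intro y hy
    obtain ⟨⟨e, t⟩, rfl⟩ := G.toSpace_surjective y
    have hy' : 0 < G.bump 0 q.1 ⟨e, t⟩ := hy
    have he : e = q.1 := G.preProj_of_bump_ne_zero hy'.ne'
    rw [← he]
    exact ⟨t, rfl⟩

end MetricGraph

/-! ### The local principle -/

/-- Operators whose matrix is compact away from the three main diagonals almost commute with
slowly increasing diagonal operators, up to a compact operator. -/
lemma LpDecomp.exists_compact_commutator {E : Type*} [NormedAddCommGroup E] [NormedSpace ℂ E]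
    [CompleteSpace E] {P : ℤ → E →L[ℂ] E} {p : ℝ} (hP : LpDecomp P p) (hp : 0 < p) (I : Finset ℤ)
    (hI : ∀ i ∉ I, P i = 0) {A : E →L[ℂ] E}
    (hA : ∀ i j, 2 ≤ |i - j| → IsCompactOperator (P i ∘L A ∘L P j)) {c : ℝ} (hc : 0 ≤ c) :
    ∃ K : E →L[ℂ] E, IsCompactOperator K ∧
      ‖A ∘L (∑ i ∈ I, ((c * i : ℝ) : ℂ) • P i) - (∑ i ∈ I, ((c * i : ℝ) : ℂ) • P i) ∘L A - K‖ ≤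
        2 * c * ‖A‖ := by
  have hbound : ∀ σ : ℤ → ℤ, ∀ i, ‖P i ∘L A ∘L P (σ i)‖ ≤ ‖A‖ := by
    intro σ i
    refine (ContinuousLinearMap.opNorm_comp_le _ _).trans ?_
    refine (mul_le_of_le_one_left (norm_nonneg _) (hP.norm_le_one hp i)).trans ?_
    refine (ContinuousLinearMap.opNorm_comp_le _ _).trans ?_
    exact mul_le_of_le_one_right (norm_nonneg _) (hP.norm_le_one hp _)
  -- `D` and `D'` are the two diagonals of `A` next to the main one. The commutator has entries `c *
  -- (j - i)` times those of `A`: it vanishes on the main diagonal, equals `c • (D - D')` next to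
  -- it, and `K` collects the rest.
  obtain ⟨D, hD, hDn⟩ := hP.exists_blockOp hp (fun _ => A) (σ := fun i => i + 1)
    (add_left_injective 1) (norm_nonneg A) (hbound _)
  obtain ⟨D', hD', hDn'⟩ := hP.exists_blockOp hp (fun _ => A) (σ := fun i => i - 1)
    sub_left_injective (norm_nonneg A) (hbound _)
  set φ : E →L[ℂ] E := ∑ i ∈ I, ((c * i : ℝ) : ℂ) • P i with hφ
  set K : E →L[ℂ] E := ∑ i ∈ I, ∑ j ∈ I with 2 ≤ |i - j|,
    ((c * (j - i) : ℝ) : ℂ) • (P i ∘L A ∘L P j) with hK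
  have hKc : IsCompactOperator K := by
    have h1 : K ∈ compactOperator (RingHom.id ℂ) E E := by
      refine Submodule.sum_mem _ fun i _ => Submodule.sum_mem _ fun j hj => Submodule.smul_mem _ _ ?_
      exact hA i j (Finset.mem_filter.1 hj).2
    exact h1
  have hid : ∀ u : E, ∑ j ∈ I, P j u = u := by
    intro u
    have := hP.finProj_eq_self hp (S := I) (u := u) fun a ha => by
      by_contra h
      exact ha (by rw [hI a h]; rfl)
    simpa [finProj, sum_apply] using this
  have hPφ : ∀ i u, P i (φ u) = ((c * i : ℝ) : ℂ) • P i u := by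
    intro i u
    by_cases hi : i ∈ I
    · have := hP.apply_sum I (fun j => ((c * j : ℝ) : ℂ) • u) i
      rw [if_pos hi] at this
      simpa [hφ, sum_apply] using this
    · simp [hI i hi]
  have hPK : ∀ i u, P i (K u) = ∑ j ∈ I with 2 ≤ |i - j|,
      ((c * (j - i) : ℝ) : ℂ) • P i (A (P j u)) := by
    intro i u
    by_cases hi : i ∈ I
    · have h1 : K u = ∑ i ∈ I, P i (∑ j ∈ I with 2 ≤ |i - j|,
          ((c * (j - i) : ℝ) : ℂ) • A (P j u)) := by
        simp [hK, sum_apply]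
      rw [h1, hP.apply_sum I (fun i => ∑ j ∈ I with 2 ≤ |i - j|,
          ((c * (j - i) : ℝ) : ℂ) • A (P j u)) i, if_pos hi]
      simp
    · simp [hI i hi]
  have hrem : A ∘L φ - φ ∘L A - K = (c : ℂ) • (D - D') := by
    ext1 u
    refine hP.ext hp fun i => ?_
    have h1 : P i (A (φ u)) = ∑ j ∈ I, ((c * j : ℝ) : ℂ) • P i (A (P j u)) := by
      simp [hφ, sum_apply]
    have h2 : P i (φ (A u)) = ∑ j ∈ I, ((c * i : ℝ) : ℂ) • P i (A (P j u)) := by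
      rw [hPφ, ← Finset.smul_sum, ← map_sum, ← map_sum, hid]
    have h3 : P i ((A ∘L φ - φ ∘L A - K) u) = ∑ j ∈ I with ¬ 2 ≤ |i - j|,
        ((c * (j - i) : ℝ) : ℂ) • P i (A (P j u)) := by
      simp only [_root_.sub_apply, ContinuousLinearMap.comp_apply, map_sub]
      rw [h1, h2, hPK, ← Finset.sum_sub_distrib, sub_eq_iff_eq_add, add_comm,
        Finset.sum_filter_add_sum_filter_not]
      refine Finset.sum_congr rfl fun j _ => ?_
      rw [← sub_smul]
      congr 1
      push_cast
      ring
    have h4 : ∑ j ∈ I with ¬ 2 ≤ |i - j|, ((c * (j - i) : ℝ) : ℂ) • P i (A (P j u)) =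
        ∑ j ∈ ({i - 1, i, i + 1} : Finset ℤ), ((c * (j - i) : ℝ) : ℂ) • P i (A (P j u)) := by
      refine Finset.sum_subset (fun j hj => ?_) fun j hj hj' => ?_
      · have h5 := (Finset.mem_filter.1 hj).2
        simp only [Finset.mem_insert, Finset.mem_singleton]
        rw [not_le, abs_lt] at h5
        omega
      · have h5 : j ∉ I := fun h => hj' (by
          refine Finset.mem_filter.2 ⟨h, ?_⟩
          simp only [Finset.mem_insert, Finset.mem_singleton] at hj
          rw [not_le, abs_lt]
          omega)
        simp [hI j h5]
    rw [h3, h4, Finset.sum_insert (by simp; omega), Finset.sum_insert (by simp),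
      Finset.sum_singleton]
    simp only [_root_.smul_apply, _root_.sub_apply, map_smul, map_sub, hD, hD']
    push_cast
    simp [smul_sub]
    abel
  refine ⟨K, hKc, ?_⟩
  rw [hrem, norm_smul, Complex.norm_real, Real.norm_of_nonneg hc]
  have := (norm_sub_le D D').trans (add_le_add hDn hDn')
  nlinarith

section Local

variable {α X : Type*} [MeasurableSpace α] {μ : Measure α} {p : ℝ≥0∞} [Fact (1 ≤ p)]
  [TopologicalSpace X] [MeasurableSpace X] [BorelSpace X]

/-- Approximate cutoff operators. -/
lemma exists_cutoff [NormalSpace X] (hp : p ≠ ∞) {π : α → X} (hπ : Measurable π)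
    {A : Lp ℂ p μ →L[ℂ] Lp ℂ p μ}
    (hA : ∀ (F₁ F₂ : Set X) (h₁ : IsOpen F₁) (h₂ : IsOpen F₂),
      Disjoint (closure F₁) (closure F₂) →
      IsCompactOperator (chi μ p (π ⁻¹' F₁) (hπ h₁.measurableSet) ∘L A ∘L
        chi μ p (π ⁻¹' F₂) (hπ h₂.measurableSet)))
    {F U : Set X} (hF : IsOpen F) (hU : IsOpen U) (hUF : closure U ⊆ F) {η : ℝ} (hη : 0 < η) :
    ∃ φ T : Lp ℂ p μ →L[ℂ] Lp ℂ p μ, IsCompactOperator T ∧ ‖A ∘L φ - φ ∘L A - T‖ ≤ η ∧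
      chi μ p (π ⁻¹' U) (hπ hU.measurableSet) ∘L φ = chi μ p (π ⁻¹' U) (hπ hU.measurableSet) ∧
      φ ∘L chi μ p (π ⁻¹' U) (hπ hU.measurableSet) = chi μ p (π ⁻¹' U) (hπ hU.measurableSet) ∧
      chi μ p (π ⁻¹' F) (hπ hF.measurableSet) ∘L φ = φ ∧
      φ ∘L chi μ p (π ⁻¹' F) (hπ hF.measurableSet) = φ := by
  have hp1 : 1 ≤ p := Fact.out
  have hp0 : 0 < p.toReal := ENNReal.toReal_pos (zero_lt_one.trans_le hp1).ne' hp
  obtain ⟨f, hf0, hf1, hf⟩ := exists_continuous_zero_one_of_isClosed hF.isClosed_compl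
    isClosed_closure (disjoint_compl_left_iff_subset.2 hUF)
  -- The cutoff is a step function with steps `1 / N`, so the commutator bound is `2 * ‖A‖ / N`.
  obtain ⟨N, hN⟩ := exists_nat_gt (2 * ‖A‖ / η)
  have hN0 : (0 : ℝ) < N := lt_of_le_of_lt (by positivity) hN
  have hg : Continuous fun x => (N : ℝ) * f x := by fun_prop
  have hlev : ∀ i : ℤ, MeasurableSet {x : X | ⌈(N : ℝ) * f x⌉ = i} := fun i =>
    (Int.measurable_ceil.comp hg.measurable) (measurableSet_singleton i)
  set S : ℤ → Set α := fun i => π ⁻¹' {x | ⌈(N : ℝ) * f x⌉ = i} with hS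
  have hSm : ∀ i, MeasurableSet (S i) := fun i => hπ (hlev i)
  have hP := lpDecomp_chi (μ := μ) hp S hSm fun x =>
    ⟨⌈(N : ℝ) * f (π x)⌉, rfl, fun j hj => hj.symm⟩
  have hI : ∀ i ∉ Finset.Icc (0 : ℤ) N, chi μ p (S i) (hSm i) = 0 := by
    intro i hi
    have hempty : S i = ∅ := by
      rw [eq_empty_iff_forall_notMem]
      intro x hx
      have hx' : ⌈(N : ℝ) * f (π x)⌉ = i := hx
      apply hi
      have h1 := hf (π x)
      rw [Finset.mem_Icc, ← hx']
      constructor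
      · exact Int.ceil_nonneg (mul_nonneg hN0.le h1.1)
      · rw [Int.ceil_le]
        push_cast
        exact mul_le_of_le_one_right hN0.le h1.2
    ext1 u
    rw [chi_congr _ MeasurableSet.empty hempty, chi_empty]
    rfl
  -- On level `i` the function `N * f` is at most `i`, on level `j` it exceeds `i + 1`. The
  -- thresholds `i + 1 / 3` and `i + 2 / 3` give open sets with disjoint closures, so the local type
  -- applies.
  have hfar : ∀ i j : ℤ, i + 2 ≤ j →
      IsCompactOperator (chi μ p (S i) (hSm i) ∘L A ∘L chi μ p (S j) (hSm j)) ∧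
      IsCompactOperator (chi μ p (S j) (hSm j) ∘L A ∘L chi μ p (S i) (hSm i)) := by
    intro i j hij
    have hij' : (i : ℝ) + 2 ≤ j := by exact_mod_cast hij
    have ho₁ : IsOpen {x | (N : ℝ) * f x < i + 1 / 3} := isOpen_lt hg continuous_const
    have ho₂ : IsOpen {x | (i : ℝ) + 2 / 3 < N * f x} := isOpen_lt continuous_const hg
    have hd : Disjoint (closure {x | (N : ℝ) * f x < i + 1 / 3})
        (closure {x | (i : ℝ) + 2 / 3 < N * f x}) := by
      refine Disjoint.mono (closure_lt_subset_le hg continuous_const)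
        (closure_lt_subset_le continuous_const hg) (Set.disjoint_left.2 fun x hx hx' => ?_)
      simp only [mem_ofPred_eq] at hx hx'
      linarith
    have hs₁ : S i ⊆ π ⁻¹' {x | (N : ℝ) * f x < i + 1 / 3} := fun x hx => by
      have hx' : ⌈(N : ℝ) * f (π x)⌉ = i := hx
      have := Int.le_ceil ((N : ℝ) * f (π x))
      rw [hx'] at this
      simp only [mem_preimage, mem_ofPred_eq]
      linarith
    have hs₂ : S j ⊆ π ⁻¹' {x | (i : ℝ) + 2 / 3 < N * f x} := fun x hx => by
      have hx' : ⌈(N : ℝ) * f (π x)⌉ = j := hx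
      have := Int.ceil_lt_add_one ((N : ℝ) * f (π x))
      rw [hx'] at this
      simp only [mem_preimage, mem_ofPred_eq]
      linarith
    constructor
    · have h1 := ((hA _ _ ho₁ ho₂ hd).comp_clm (chi μ p (S j) (hSm j))).clm_comp
        (chi μ p (S i) (hSm i))
      refine (congrArg IsCompactOperator ?_).mp h1
      funext u
      simp only [Function.comp_apply, ContinuousLinearMap.comp_apply,
        chi_apply_chi_of_subset _ _ hs₁, chi_apply_chi_of_superset _ _ hs₂]
    · have h1 := ((hA _ _ ho₂ ho₁ hd.symm).comp_clm (chi μ p (S i) (hSm i))).clm_comp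
        (chi μ p (S j) (hSm j))
      refine (congrArg IsCompactOperator ?_).mp h1
      funext u
      simp only [Function.comp_apply, ContinuousLinearMap.comp_apply,
        chi_apply_chi_of_subset _ _ hs₂, chi_apply_chi_of_superset _ _ hs₁]
  obtain ⟨T, hT, hTn⟩ := hP.exists_compact_commutator hp0 (Finset.Icc (0 : ℤ) N) hI (A := A)
    (fun i j hij => by
      rcases le_total i j with h | h
      · exact (hfar i j (by rw [abs_of_nonpos (by omega)] at hij; omega)).1
      · exact (hfar j i (by rw [abs_of_nonneg (by omega)] at hij; omega)).2)
    (c := (N : ℝ)⁻¹) (by positivity)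
  set φ := ∑ i ∈ Finset.Icc (0 : ℤ) N, (((N : ℝ)⁻¹ * i : ℝ) : ℂ) • chi μ p (S i) (hSm i) with hφ
  have hφa : ∀ u, φ u = ∑ i ∈ Finset.Icc (0 : ℤ) N, (((N : ℝ)⁻¹ * i : ℝ) : ℂ) •
      chi μ p (S i) (hSm i) u := fun u => by simp [hφ, sum_apply]
  have hUN : π ⁻¹' U ⊆ S N := fun x hx => by
    have h1 : f (π x) = 1 := hf1 (subset_closure hx)
    simp [hS, h1]
  have hUi : ∀ i : ℤ, i ≠ N → Disjoint (π ⁻¹' U) (S i) := fun i hi =>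
    Set.disjoint_left.2 fun x hx hx' => by
      have h2 : ⌈(N : ℝ) * f (π x)⌉ = N := hUN hx
      exact hi (Eq.trans (Eq.symm hx') h2)
  have hFi : ∀ i : ℤ, i ≠ 0 → S i ⊆ π ⁻¹' F := fun i hi x hx => by
    by_contra hcon
    have h1 : f (π x) = 0 := hf0 hcon
    have hx' : ⌈(N : ℝ) * f (π x)⌉ = i := hx
    rw [h1, mul_zero, Int.ceil_zero] at hx'
    exact hi hx'.symm
  have hNN : (((N : ℝ)⁻¹ * ((N : ℤ) : ℝ) : ℝ) : ℂ) = 1 := by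
    push_cast
    exact inv_mul_cancel₀ (by exact_mod_cast hN0.ne')
  refine ⟨φ, T, hT, hTn.trans ?_, ?_, ?_, ?_, ?_⟩
  · rw [div_lt_iff₀ hη] at hN
    rw [mul_right_comm, mul_inv_le_iff₀ hN0]
    linarith
  · ext1 u
    rw [ContinuousLinearMap.comp_apply, hφa, map_sum, Finset.sum_eq_single (N : ℤ)]
    · rw [hNN, one_smul, chi_apply_chi_of_subset _ _ hUN]
    · intro i _ hi
      rw [map_smul, chi_apply_chi_of_disjoint _ _ (hUi i hi), smul_zero]
    · simp
  · ext1 u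
    rw [ContinuousLinearMap.comp_apply, hφa, Finset.sum_eq_single (N : ℤ)]
    · rw [hNN, one_smul, chi_apply_chi_of_superset _ _ hUN]
    · intro i _ hi
      rw [chi_apply_chi_of_disjoint _ _ (hUi i hi).symm, smul_zero]
    · simp
  · ext1 u
    rw [ContinuousLinearMap.comp_apply, hφa, map_sum]
    refine Finset.sum_congr rfl fun i _ => ?_
    by_cases hi : i = 0
    · simp [hi]
    · rw [map_smul, chi_apply_chi_of_superset _ _ (hFi i hi)]
  · ext1 u
    rw [ContinuousLinearMap.comp_apply, hφa, hφa]
    refine Finset.sum_congr rfl fun i _ => ?_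
    by_cases hi : i = 0
    · simp [hi]
    · rw [chi_apply_chi_of_subset _ _ (hFi i hi)]

/-- An operator of local type is Fredholm if it satisfies, locally at every point of a compact
space, a priori estimates modulo compact operators together with its adjoint. -/
theorem isFredholm_of_local [T4Space X] [CompactSpace X] (hp : p ≠ ∞) {π : α → X}
    (hπ : Measurable π) {A : Lp ℂ p μ →L[ℂ] Lp ℂ p μ}
    (hA : ∀ (F₁ F₂ : Set X) (h₁ : IsOpen F₁) (h₂ : IsOpen F₂),
      Disjoint (closure F₁) (closure F₂) →
      IsCompactOperator (chi μ p (π ⁻¹' F₁) (hπ h₁.measurableSet) ∘L A ∘L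
        chi μ p (π ⁻¹' F₂) (hπ h₂.measurableSet)))
    (hloc : ∀ x : X, ∃ (F : Set X) (hF : IsOpen F) (C : ℝ) (K K' : Lp ℂ p μ →L[ℂ] Lp ℂ p μ),
      x ∈ F ∧ 0 ≤ C ∧ IsCompactOperator K ∧ IsCompactOperator K' ∧
      (∀ u, chi μ p (π ⁻¹' F) (hπ hF.measurableSet) u = u → ‖u‖ ≤ C * ‖A u‖ + ‖K u‖) ∧
      ∀ f : StrongDual ℂ (Lp ℂ p μ), f ∘L chi μ p (π ⁻¹' F) (hπ hF.measurableSet) = f →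
        ‖f‖ ≤ C * ‖f ∘L A‖ + ‖f ∘L K'‖) : A.IsFredholm := by
  choose F hF C K K' hxF hC hK hK' hest hest' using hloc
  have hU : ∀ x, ∃ U : Set X, IsOpen U ∧ x ∈ U ∧ closure U ⊆ F x := by
    intro x
    obtain ⟨U, hU, hxU, hUF⟩ := normal_exists_closure_subset isClosed_singleton (hF x)
      (singleton_subset_iff.2 (hxF x))
    exact ⟨U, hU, singleton_subset_iff.1 hxU, hUF⟩
  choose U hU hxU hUF using hU
  obtain ⟨J, hJ⟩ := isCompact_univ.elim_finite_subcover U hU fun x _ => mem_iUnion.2 ⟨x, hxU x⟩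
  have hC0 : 0 ≤ ∑ x ∈ J, C x := Finset.sum_nonneg fun x _ => hC x
  -- The commutator errors of all cutoffs then sum to at most half of the norm and can be absorbed;
  -- this causes the factors `2` below.
  set η : ℝ := (2 * (∑ x ∈ J, C x + 1))⁻¹ with hη
  have hη0 : 0 < η := by positivity
  have hηC : (∑ x ∈ J, C x) * η ≤ 1 / 2 := by
    rw [hη, mul_inv_le_iff₀ (by positivity)]
    linarith
  have hcut := fun x => exists_cutoff hp hπ hA (hF x) (hU x) (hUF x) hη0
  choose φ T hT hTn hUφ hφU hFφ hφF using hcut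
  obtain ⟨hcov, hcov'⟩ := exists_iUnion_chi_bound (μ := μ) (p := p) J (fun x => π ⁻¹' U x)
    (fun x => hπ (hU x).measurableSet) fun a => by
      obtain ⟨x, hx, ha⟩ := mem_iUnion₂.1 (hJ (mem_univ (π a)))
      exact ⟨x, hx, ha⟩
  have hnC : ∀ x, ‖(C x : ℂ)‖ = C x := fun x => by
    rw [Complex.norm_real, Real.norm_of_nonneg (hC x)]
  refine ContinuousLinearMap.isFredholm_of_finite A ?_ ?_
  -- The local estimate is applied to `φ x u`, which lives in `F x`; moving `φ x` past `A` costs the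
  -- compact `T x` and an error of size `η`.
  · have hlocal : ∀ x u, ‖chi μ p (π ⁻¹' U x) (hπ (hU x).measurableSet) u‖ ≤
        C x * ‖φ x‖ * ‖A u‖ + (C x * ‖T x u‖ + ‖K x (φ x u)‖) + C x * η * ‖u‖ := by
      intro x u
      have h1 : ‖chi μ p (π ⁻¹' U x) (hπ (hU x).measurableSet) u‖ ≤ ‖φ x u‖ := by
        rw [← hUφ x]
        exact ((chi μ p (π ⁻¹' U x) (hπ (hU x).measurableSet)).le_of_opNorm_le
          (norm_chi_le_one _ _) (φ x u)).trans_eq (one_mul _)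
      have h2 := hest x (φ x u) (DFunLike.congr_fun (hFφ x) u)
      have h3 : A (φ x u) = φ x (A u) + T x u + (A ∘L φ x - φ x ∘L A - T x) u := by
        simp
      have h4 : ‖A (φ x u)‖ ≤ ‖φ x‖ * ‖A u‖ + ‖T x u‖ + η * ‖u‖ := by
        rw [h3]
        refine (norm_add_le _ _).trans (add_le_add ((norm_add_le _ _).trans ?_)
          (ContinuousLinearMap.le_of_opNorm_le _ (hTn x) u))
        gcongr
        exact (φ x).le_opNorm _
      have h5 := mul_le_mul_of_nonneg_left h4 (hC x)
      linarith
    refine finiteDimensional_ker_of_le_compact (C := 2 * ∑ x ∈ J, C x * ‖φ x‖) A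
      (J ×ˢ (Finset.univ : Finset Bool))
      (fun q => if q.2 then ((2 * C q.1 : ℝ) : ℂ) • T q.1 else (2 : ℂ) • (K q.1 ∘L φ q.1)) ?_ ?_
    · rintro ⟨x, b⟩ -
      cases b
      · exact ((hK x).comp_clm (φ x)).smul (2 : ℂ)
      · exact (hT x).smul ((2 * C x : ℝ) : ℂ)
    · intro u
      have h1 := (hcov u).trans (Finset.sum_le_sum fun x _ => hlocal x u)
      rw [Finset.sum_add_distrib, Finset.sum_add_distrib, ← Finset.sum_mul, ← Finset.sum_mul,
        ← Finset.sum_mul] at h1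
      have h2 : ∑ q ∈ J ×ˢ (Finset.univ : Finset Bool), ‖(if q.2 then
          ((2 * C q.1 : ℝ) : ℂ) • T q.1 else (2 : ℂ) • (K q.1 ∘L φ q.1)) u‖ =
          2 * ∑ x ∈ J, (C x * ‖T x u‖ + ‖K x (φ x u)‖) := by
        rw [Finset.sum_product, Finset.mul_sum]
        refine Finset.sum_congr rfl fun x _ => ?_
        simp [norm_smul, abs_of_nonneg (hC x)]
        ring
      rw [h2]
      have h3 := mul_le_mul_of_nonneg_right hηC (norm_nonneg u)
      linarith
  · have hlocal : ∀ x (f : StrongDual ℂ (Lp ℂ p μ)),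
        ‖f ∘L chi μ p (π ⁻¹' U x) (hπ (hU x).measurableSet)‖ ≤
        C x * ‖φ x‖ * ‖f ∘L A‖ + (C x * ‖f ∘L T x‖ + ‖f ∘L (φ x ∘L K' x)‖) +
          C x * η * ‖f‖ := by
      intro x f
      have h1 : ‖f ∘L chi μ p (π ⁻¹' U x) (hπ (hU x).measurableSet)‖ ≤ ‖f ∘L φ x‖ := by
        rw [← hφU x, ← ContinuousLinearMap.comp_assoc]
        exact (ContinuousLinearMap.opNorm_comp_le _ _).trans
          (mul_le_of_le_one_right (norm_nonneg _) (norm_chi_le_one _ _))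
      -- The dual estimate uses the other absorption property of the cutoff, with `φ x` acting on
      -- the functional.
      have h2 := hest' x (f ∘L φ x) (by rw [ContinuousLinearMap.comp_assoc, hφF x])
      have h3 : (f ∘L φ x) ∘L A = (f ∘L A) ∘L φ x - f ∘L T x -
          f ∘L (A ∘L φ x - φ x ∘L A - T x) := by
        ext u
        simp
      have h4 : ‖(f ∘L φ x) ∘L A‖ ≤ ‖φ x‖ * ‖f ∘L A‖ + ‖f ∘L T x‖ + η * ‖f‖ := by
        rw [h3]
        refine (norm_sub_le _ _).trans (add_le_add ((norm_sub_le _ _).trans ?_) ?_)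
        · gcongr
          rw [mul_comm]
          exact ContinuousLinearMap.opNorm_comp_le _ _
        · rw [mul_comm]
          exact (ContinuousLinearMap.opNorm_comp_le _ _).trans
            (mul_le_mul_of_nonneg_left (hTn x) (norm_nonneg f))
      have h5 := mul_le_mul_of_nonneg_left h4 (hC x)
      rw [ContinuousLinearMap.comp_assoc f (φ x) (K' x)] at h2
      linarith
    refine cofg_range_of_dual_le_compact (C := 2 * ∑ x ∈ J, C x * ‖φ x‖) A
      (J ×ˢ (Finset.univ : Finset Bool))
      (fun q => if q.2 then ((2 * C q.1 : ℝ) : ℂ) • T q.1 else (2 : ℂ) • (φ q.1 ∘L K' q.1)) ?_ ?_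
    · rintro ⟨x, b⟩ -
      cases b
      · exact ((hK' x).clm_comp (φ x)).smul (2 : ℂ)
      · exact (hT x).smul ((2 * C x : ℝ) : ℂ)
    · intro f
      have h1 := (hcov' f).trans (Finset.sum_le_sum fun x _ => hlocal x f)
      rw [Finset.sum_add_distrib, Finset.sum_add_distrib, ← Finset.sum_mul, ← Finset.sum_mul,
        ← Finset.sum_mul] at h1
      have h2 : ∑ q ∈ J ×ˢ (Finset.univ : Finset Bool), ‖f ∘L (if q.2 then
          ((2 * C q.1 : ℝ) : ℂ) • T q.1 else (2 : ℂ) • (φ q.1 ∘L K' q.1))‖ =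
          2 * ∑ x ∈ J, (C x * ‖f ∘L T x‖ + ‖f ∘L (φ x ∘L K' x)‖) := by
        rw [Finset.sum_product, Finset.mul_sum]
        refine Finset.sum_congr rfl fun x _ => ?_
        simp [norm_smul, abs_of_nonneg (hC x)]
        ring
      rw [h2]
      have h3 := mul_le_mul_of_nonneg_right hηC (norm_nonneg f)
      linarith

end Local

/-! ### Almost invariant boxes -/

/-- Large boxes in `ℤⁿ` are almost invariant. -/
theorem hasFolnerSets_int (n : ℕ) : HasFolnerSets (Fin n → ℤ) := by
  intro F ε hε
  set m : ℕ := ∑ β ∈ F, ∑ i, (β i).natAbs with hm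
  have hβm : ∀ β ∈ F, ∀ i, |β i| ≤ m := fun β hβ i => by
    have h1 : (β i).natAbs ≤ ∑ i, (β i).natAbs :=
      Finset.single_le_sum (f := fun i => (β i).natAbs) (fun _ _ => Nat.zero_le _)
        (Finset.mem_univ i)
    have h2 : ∑ i, (β i).natAbs ≤ m :=
      Finset.single_le_sum (f := fun β : Fin n → ℤ => ∑ i, (β i).natAbs)
        (fun _ _ => Nat.zero_le _) hβ
    rw [Int.abs_eq_natAbs]
    exact_mod_cast h1.trans h2
  let box : ℕ → Finset (Fin n → ℤ) := fun d => Finset.Icc (fun _ => -(d : ℤ)) fun _ => (d : ℤ)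
  have hcard : ∀ d, (box d).card = (2 * d + 1) ^ n := fun d => by
    simp only [box, Pi.card_Icc, Int.card_Icc, Finset.prod_const, Finset.card_univ,
      Fintype.card_fin]
    congr 1
    omega
  have hmem : ∀ d x, x ∈ box d ↔ ∀ i, |x i| ≤ d := fun d x => by
    simp only [box, Finset.mem_Icc, Pi.le_def, abs_le, forall_and]
  have hlim : Tendsto (fun k : ℕ => ((2 * k + 1 : ℝ) / (2 * (m + k) + 1)) ^ n) atTop (𝓝 1) := by
    have h1 : Tendsto (fun k : ℕ => (2 * (m + k : ℝ) + 1)) atTop atTop :=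
      tendsto_atTop_add_const_right _ _ ((tendsto_atTop_add_const_left _ _
        tendsto_natCast_atTop_atTop).const_mul_atTop two_pos)
    have h2 := ((tendsto_const_nhds (x := (2 * m : ℝ))).div_atTop h1).const_sub 1
    have h3 : ∀ k : ℕ, 1 - 2 * (m : ℝ) / (2 * (m + k) + 1) = (2 * k + 1) / (2 * (m + k) + 1) := by
      intro k
      have : (2 * (m + k : ℝ) + 1) ≠ 0 := by positivity
      field_simp
      ring
    simpa using (h2.congr h3).pow n
  -- The box of radius `k` fills more than the fraction `1 - ε / 2` of the box of radius `m + k`.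
  -- Since `m` bounds all coordinates occurring in `F`, it is contained in the large box and in its
  -- translates, so each of the two differences has at most `ε / 2` of the cardinality.
  obtain ⟨k, hk⟩ := (hlim.eventually_const_lt (u := 1 - ε / 2) (by linarith)).exists
  have hpos : (0 : ℝ) < (2 * (m + k) + 1) ^ n := by positivity
  rw [div_pow, lt_div_iff₀ hpos] at hk
  have hB : ((box (m + k)).card : ℝ) = (2 * (m + k) + 1) ^ n := by
    rw [hcard]
    push_cast
    ring
  have hB' : ((box k).card : ℝ) = (2 * k + 1) ^ n := by
    rw [hcard]
    push_cast
    ring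
  refine ⟨box (m + k), ⟨0, (hmem _ _).2 fun i => by simp; omega⟩, fun β hβ => ?_⟩
  have hs : box k ⊆ box (m + k) := fun x hx => (hmem _ _).2 fun i => by
    have := (hmem _ _).1 hx i
    push_cast
    omega
  have hs' : box k ⊆ (box (m + k)).image (· + β) := fun x hx => by
    refine Finset.mem_image.2 ⟨x - β, (hmem _ _).2 fun i => ?_, sub_add_cancel x β⟩
    have h1 := (hmem _ _).1 hx i
    have h2 := hβm β hβ i
    have h3 := abs_sub (x i) (β i)
    rw [Pi.sub_apply]
    push_cast
    omega
  have hi : ((box (m + k)).image (· + β)).card = (box (m + k)).card :=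
    Finset.card_image_of_injective _ (add_left_injective β)
  have h1 : (symmDiff (box (m + k)) ((box (m + k)).image (· + β))).card ≤
      (box (m + k) \ box k).card + ((box (m + k)).image (· + β) \ box k).card := by
    refine (Finset.card_union_le _ _).trans (add_le_add ?_ ?_)
    · exact Finset.card_le_card (Finset.sdiff_subset_sdiff subset_rfl hs')
    · exact Finset.card_le_card (Finset.sdiff_subset_sdiff subset_rfl hs)
  have h2 : ((box (m + k) \ box k).card : ℝ) = (box (m + k)).card - (box k).card :=
    Finset.cast_card_sdiff hs
  have h3 : (((box (m + k)).image (· + β) \ box k).card : ℝ) =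
      (box (m + k)).card - (box k).card := by
    rw [Finset.cast_card_sdiff hs', hi]
  have h4 : ((symmDiff (box (m + k)) ((box (m + k)).image (· + β))).card : ℝ) ≤
      (box (m + k) \ box k).card + ((box (m + k)).image (· + β) \ box k).card := by
    exact_mod_cast h1
  rw [h2, h3, hB, hB'] at h4
  rw [hB]
  linarith

/-! ### Fredholmness, local Fredholmness and a priori estimates -/

section Fredholm

variable {n : ℕ} {V : Type*} {Γ : PeriodicMetricGraph n V} {w : PeriodicWeight Γ}
  {p : ℝ≥0∞} [Fact (1 ≤ p)]

lemma ContinuousLinearMap.IsFredholm.isLocallyFredholmAt {A : LpW Γ w p →L[ℂ] LpW Γ w p}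
    (hA : A.IsFredholm) (x : OnePoint Γ.Space) : IsLocallyFredholmAt A x := by
  obtain ⟨L, h1, h2⟩ := hA.exists_regularizer
  have huniv : chiOpen Γ w p univ isOpen_univ = ContinuousLinearMap.id ℂ (LpW Γ w p) := by
    ext1 u
    exact (DFunLike.congr_fun (chi_congr _ MeasurableSet.univ preimage_univ) u).trans (chi_univ u)
  refine ⟨univ, isOpen_univ, L, L, mem_univ x, ?_, ?_⟩
  · rw [huniv]
    exact h1
  · rw [huniv]
    exact h2

/-- Local Fredholmness yields local a priori estimates. -/
lemma IsLocallyFredholmAt.exists_estimate {A : LpW Γ w p →L[ℂ] LpW Γ w p}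
    {x : OnePoint Γ.Space} (hA : IsLocallyFredholmAt A x) :
    ∃ (F : Set (OnePoint Γ.Space)) (hF : IsOpen F) (C : ℝ) (K K' : LpW Γ w p →L[ℂ] LpW Γ w p),
      x ∈ F ∧ 0 ≤ C ∧ IsCompactOperator K ∧ IsCompactOperator K' ∧
      (∀ u, chiOpen Γ w p F hF u = u → ‖u‖ ≤ C * ‖A u‖ + ‖K u‖) ∧
      ∀ f : StrongDual ℂ (LpW Γ w p), f ∘L chiOpen Γ w p F hF = f →
        ‖f‖ ≤ C * ‖f ∘L A‖ + ‖f ∘L K'‖ := by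
  obtain ⟨F, hF, L, R, hx, hL, hR⟩ := hA
  refine ⟨F, hF, max ‖L‖ ‖R‖, _, _, hx, (norm_nonneg L).trans (le_max_left _ _), hL, hR,
    fun u hu => ?_, fun f hf => ?_⟩
  · have h1 : u = L (A u) - (L ∘L A ∘L chiOpen Γ w p F hF - chiOpen Γ w p F hF) u := by
      simp [hu]
    calc ‖u‖ ≤ ‖L (A u)‖ + _ := (congrArg norm h1).le.trans (norm_sub_le _ _)
      _ ≤ _ := by
        gcongr
        exact (L.le_opNorm _).trans (by gcongr; exact le_max_left _ _)
  · have h1 : f = (f ∘L A) ∘L R -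
        f ∘L (chiOpen Γ w p F hF ∘L A ∘L R - chiOpen Γ w p F hF) := by
      rw [ContinuousLinearMap.comp_sub, ← ContinuousLinearMap.comp_assoc f, hf,
        ContinuousLinearMap.comp_assoc]
      abel
    calc ‖f‖ ≤ ‖(f ∘L A) ∘L R‖ + _ := (congrArg norm h1).le.trans (norm_sub_le _ _)
      _ ≤ _ := by
        gcongr
        refine (ContinuousLinearMap.opNorm_comp_le _ _).trans ?_
        rw [mul_comm]
        gcongr
        exact le_max_right _ _

end Fredholm

end

/-! ### The Fredholm criterion -/

theorem theoremt1 {n : ℕ} {V : Type*} [Countable V] [Infinite V]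
    (Γ : PeriodicMetricGraph n V) (w : PeriodicWeight Γ)
    (p : ℝ≥0∞) [Fact (1 ≤ p)] (hp₁ : 1 < p) (hp₂ : p < ∞)
    (D : Set Γ.Space) (hD : IsFundDomain Γ D)
    (A : LpW Γ w p →L[ℂ] LpW Γ w p)
    (hW : InWiener hD A) (hrich : IsRich A) (hlocal : IsLocalType A) :
    A.IsFredholm ↔
      (∀ x : Γ.Space, IsLocallyFredholmAt A (x : OnePoint Γ.Space)) ∧
      ∀ (h : ℕ → Fin n → ℤ) (B : LpW Γ w p →L[ℂ] LpW Γ w p),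
        TendsToInfinity h → IsLimitOperator A h B → IsUnit B := by
  have hp : 1 < p.toReal := by
    rw [← ENNReal.toReal_one]
    exact (ENNReal.toReal_lt_toReal ENNReal.one_ne_top hp₂.ne).2 hp₁
  have hP := hD.lpDecomp (w := w) hp₂.ne
  have hV := hD.isShiftFamily (w := w) (p := p)
  constructor
  · intro hA
    refine ⟨fun x => hA.isLocallyFredholmAt x, fun h B hh hB => ?_⟩
    exact isUnit_limit_of_isFredholm hP hp hV hA hh (fun S => (hB.tendsto_finProj hD S).1)
      fun S => (hB.tendsto_finProj hD S).2
  · rintro ⟨hloc, hlim⟩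
    obtain ⟨S, c, hc, hlow, hlow'⟩ := exists_lower_bounds_of_isUnit_limits hP hp
      (hasFolnerSets_int n) hV (A := A) hW fun h hh => by
        obtain ⟨φ, hφ, B, hB⟩ := hrich h hh
        exact ⟨φ, hφ, B, hlim _ B (hh.comp hφ.tendsto_atTop) hB,
          fun S => (hB.tendsto_finProj hD S).1, fun S => (hB.tendsto_finProj hD S).2⟩
    let _ : MeasurableSpace (OnePoint Γ.Space) := borel _
    have _ : BorelSpace (OnePoint Γ.Space) := ⟨rfl⟩
    refine isFredholm_of_local hp₂.ne (π := ((↑) : Γ.Space → OnePoint Γ.Space))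
      OnePoint.continuous_coe.measurable hlocal fun x => ?_
    induction x using OnePoint.rec with
    | coe y => exact (hloc y).exists_estimate
    | infty =>
      -- The complement of the compact set of closed cells is a neighborhood of infinity. Functions
      -- and functionals living there are annihilated by the projection onto `S`, so the bounds
      -- `hlow` and `hlow'` hold without compact terms.
      have hF : IsOpen ((↑) '' closedCells D S : Set (OnePoint Γ.Space))ᶜ :=
        OnePoint.isOpen_compl_image_coe.2 ⟨isClosed_closedCells D S, hD.isCompact_closedCells S⟩
      have hdisj : ∀ a ∈ S, Disjoint (cell D a)
          (((↑) : Γ.Space → OnePoint Γ.Space) ⁻¹' ((↑) '' closedCells D S)ᶜ) := fun a ha =>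
        Set.disjoint_left.2 fun x hx hx' => hx' ⟨x, cell_subset_closedCells D ha hx, rfl⟩
      have hm := (hF.preimage OnePoint.continuous_coe).measurableSet
      refine ⟨_, hF, c⁻¹, 0, 0, OnePoint.infty_notMem_image_coe, (inv_pos.2 hc).le,
        isCompactOperator_zero, isCompactOperator_zero, fun u hu => ?_, fun f hf => ?_⟩
      · have h1 := hlow u (by
          rw [← hu]
          simp only [finProj, sum_apply]
          exact Finset.sum_eq_zero fun a ha => chi_apply_chi_of_disjoint _ hm (hdisj a ha) u)
        rw [_root_.zero_apply, norm_zero, add_zero, le_inv_mul_iff₀ hc]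
        exact h1
      · have h1 := hlow' f (by
          rw [← hf]
          ext u
          simp only [finProj, sum_apply, ContinuousLinearMap.comp_apply, map_sum]
          exact Finset.sum_eq_zero fun a ha =>
            (congrArg f (chi_apply_chi_of_disjoint hm _ (hdisj a ha).symm u)).trans (map_zero f))
        rw [ContinuousLinearMap.comp_zero, norm_zero, add_zero, le_inv_mul_iff₀ hc]
        exact h1
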